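/- Let $A\in\mathbb{R}^{n\times n}$ and $b,c\in\mathbb{R}^n$ with $(A,b)$ controllable, let $\Omega\subset\mathbb{R}^n$ be compact and convex, $\theta\in\Omega$, and let $r:[0,\infty)\to\mathbb{R}$ be bounded and continuous. Consider the plant $$\dot x(t)=Ax(t)+b\,(u(t)-\theta^\top x(t)),\qquad x(0)=x_0 .$$ Let $K\in\mathbb{R}^n$ be such that $A_m=A-bK^\top$ is Hurwitz, put $H_o(s)=(sI-A_m)^{-1}b$, assume $c^\top H_o(0)\neq 0$ and put $k_g=1/(c^\top H_o(0))$. Let $C(s)$ be a stable strictly proper rational transfer function with $C(0)=1$, let $Q$ be symmetric positive definite, let $P$ solve $A_m^\top P+PA_m=-Q$, and let $\Gamma_c>0$. The $\mathcal{L}_1$ adaptive controller is $$u(t)=-K^\top x(t)+u_2(t),\qquad u_2(s)=C(s)\big(\bar r(s)+k_g r(s)\big),\qquad \bar r(t)=\hat\theta(t)^\top x(t),$$ $$\dot{\hat x}(t)=A_m\hat x(t)-b\,\hat\theta(t)^\top x(t)+b\,u_2(t),\qquad \hat x(0)=x_0,$$ $$\dot{\hat\theta}(t)=\Gamma_c\,\mathrm{Proj}\big(\hat\theta(t),\,x(t)\,(\hat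 x(t)-x(t))^\top Pb\big),\qquad \hat\theta(0)=\hat\theta_0\in\Omega .$$ Here $\mathrm{Proj}(\vartheta,y)$ is the Euclidean projection of $y$ onto the closed convex cone generated by $\Omega-\vartheta$ (the tangent cone of $\Omega$ at $\vartheta$ if $\vartheta\in\Omega$), the last equation is understood in the sense of Carathéodory ($\hat\theta$ is locally absolutely continuous and the equation holds for almost every $t$), and multiplication by $C(s)$ denotes the response of $C$, started at rest, that is, convolution with its impulse response. Assume the $\mathcal{L}_1$-gain requirement $$\|\bar G(s)\|_{\mathcal{L}_1}\,\theta_{\max}<1,\qquad \bar G(s)=H_o(s)(C(s)-1),\qquad \theta_{\max}=\max_{\vartheta\in\Omega}\sum_{i=1}^n|\vartheta_i| ,$$ where $\|\bar G(s)\|_{\mathcal{L}_1}=\max_i\int_0^\infty|\bar g_i(t)|\,dt$ and $\bar g$ is the impulse response of $\bar G$. Let $x,\hat x,\hat\theta,u,u_2$ be a solution of this closed loop on $[0,\infty)$, and let $x_{ref},u_{ref}$ be a solution on $[0,\infty)$, with any initial state $x_{ref}(0)$, of the nonadaptive reference system $$\dot x_{ref}(t)=Ax_{ref}(t)+b\,(u_{ref}(t)-\theta^\top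 x_{ref}(t)),\qquad u_{ref}(s)=C(s)\big(k_g r(s)+\eta(s)\big)-K^\top x_{ref}(s),\qquad \eta(t)=\theta^\top x_{ref}(t).$$ Then $$\lim_{t\to\infty}\|x(t)-x_{ref}(t)\|=0\qquad\text{and}\qquad \lim_{t\to\infty}|u(t)-u_{ref}(t)|=0 .$$ -/

import Mathlib

open Set Filter Topology MeasureTheory
open scoped Matrix ENNReal

noncomputable section

namespace L1Adaptive

/-- A real square matrix is Hurwitz if all its (complex) eigenvalues have negative real part. -/
def IsHurwitz {n : ℕ} (A : Matrix (Fin n) (Fin n) ℝ) : Prop :=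
  ∀ z ∈ spectrum ℂ (A.map (algebraMap ℝ ℂ)), z.re < 0

/-- Controllability of the pair `(A, b)` (Kalman): the vectors `b, A b, …, A ^ (n - 1) b`
span `ℝⁿ`. -/
def IsControllable {n : ℕ} (A : Matrix (Fin n) (Fin n) ℝ) (b : Fin n → ℝ) : Prop :=
  Submodule.span ℝ (range fun k : Fin n => (A ^ (k : ℕ)) *ᵥ b) = ⊤

/-- The impulse response `t ↦ exp (t A) b` of the single-input, `n`-output strictly proper
system `(s I - A)⁻¹ b`. -/
def stateImpulse {n : ℕ} (A : Matrix (Fin n) (Fin n) ℝ) (b : Fin n → ℝ) (t : ℝ) : Fin n → ℝ :=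
  NormedSpace.exp (t • A) *ᵥ b

/-- The transfer function `s ↦ cᵀ (s I - A)⁻¹ b` (at real arguments). -/
def transferFn {n : ℕ} (A : Matrix (Fin n) (Fin n) ℝ) (b c : Fin n → ℝ) (s : ℝ) : ℝ :=
  c ⬝ᵥ ((s • (1 : Matrix (Fin n) (Fin n) ℝ) - A)⁻¹ *ᵥ b)

/-- A single-input single-output strictly proper LTI system of finite order, given by a
state-space realization; its transfer function is `cᵀ (s I - A)⁻¹ b`. -/
structure StrictlyProperSystem where
  /-- the order of the realization -/
  order : ℕ
  /-- the state matrix -/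
  A : Matrix (Fin order) (Fin order) ℝ
  /-- the input vector -/
  b : Fin order → ℝ
  /-- the output vector -/
  c : Fin order → ℝ

namespace StrictlyProperSystem

/-- Stability. Every strictly proper rational transfer function with poles in the open left half
plane has a realization that is stable in this sense, and conversely. -/
def Stable (C : StrictlyProperSystem) : Prop := IsHurwitz C.A

/-- The transfer function `C(s)`. -/
def transfer (C : StrictlyProperSystem) (s : ℝ) : ℝ := transferFn C.A C.b C.c s

/-- The impulse response of `C(s)`. -/
def impulse (C : StrictlyProperSystem) (t : ℝ) : ℝ := C.c ⬝ᵥ stateImpulse C.A C.b t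

/-- The signal with Laplace transform `C(s) v(s)`: the response of the system, started at rest,
to the input `v`. -/
def response (C : StrictlyProperSystem) (v : ℝ → ℝ) (t : ℝ) : ℝ :=
  ∫ τ in (0 : ℝ)..t, C.impulse (t - τ) * v τ

end StrictlyProperSystem

/-- The `L₁` gain of a single-input, `n`-output system with impulse response `g`:
`max_i ∫₀^∞ |g_i(t)| dt`. -/
def l1Gain {n : ℕ} (g : ℝ → Fin n → ℝ) : ℝ≥0∞ :=
  ⨆ i, ∫⁻ t in Ioi (0 : ℝ), ‖g t i‖ₑ

/-- The impulse response of `Ḡ(s) = H_o(s) (C(s) - 1)`, where `H_o(s) = (s I - A_m)⁻¹ b`. -/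
def gBar {n : ℕ} (Am : Matrix (Fin n) (Fin n) ℝ) (b : Fin n → ℝ) (C : StrictlyProperSystem)
    (t : ℝ) : Fin n → ℝ :=
  fun i => (∫ τ in (0 : ℝ)..t, stateImpulse Am b (t - τ) i * C.impulse τ) - stateImpulse Am b t i

/-- `θ_max = max_{θ ∈ Ω} ∑ i, |θ i|`. -/
def thetaMax {n : ℕ} (Ω : Set (Fin n → ℝ)) : ℝ :=
  sSup ((fun θ : Fin n → ℝ => ∑ i, |θ i|) '' Ω)

/-- `A_m = A - b Kᵀ`. -/
def closedMatrix {n : ℕ} (A : Matrix (Fin n) (Fin n) ℝ) (b K : Fin n → ℝ) :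
    Matrix (Fin n) (Fin n) ℝ :=
  A - Matrix.vecMulVec b K

/-- `k_g = 1 / (cᵀ H_o(0))`. -/
def kg {n : ℕ} (Am : Matrix (Fin n) (Fin n) ℝ) (b c : Fin n → ℝ) : ℝ :=
  1 / transferFn Am b c 0

/-- The closed cone of directions from `θ` into `Ω`. For `Ω` convex and `θ ∈ Ω` this is the
tangent cone of `Ω` at `θ`; in the interior of `Ω` it is the whole space. -/
def dirCone {n : ℕ} (Ω : Set (Fin n → ℝ)) (θ : Fin n → ℝ) : Set (Fin n → ℝ) :=
  closure {v | ∃ z ∈ Ω, ∃ a : ℝ, 0 ≤ a ∧ v = a • (z - θ)}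

/-- `p` is a point of `S` at the least Euclidean distance from `y`. -/
def IsNearest {n : ℕ} (S : Set (Fin n → ℝ)) (y p : Fin n → ℝ) : Prop :=
  p ∈ S ∧ ∀ v ∈ S, (y - p) ⬝ᵥ (y - p) ≤ (y - v) ⬝ᵥ (y - v)

/-- The projection operator `Proj(θ, y)` of adaptive control for the convex set `Ω`: the
Euclidean projection of the nominal update direction `y` onto the tangent cone of `Ω` at `θ`.
It equals `y` in the interior of `Ω` and removes the outward normal component of `y` on the
boundary. -/
def Proj {n : ℕ} (Ω : Set (Fin n → ℝ)) (θ y : Fin n → ℝ) : Fin n → ℝ :=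
  Classical.epsilon (IsNearest (dirCone Ω θ) y)

/-- The nearest point in the definition of `Proj` exists and is unique. -/
theorem existsUnique_isNearest {n : ℕ} {Ω : Set (Fin n → ℝ)} (hΩ : Convex ℝ Ω)
    (hne : Ω.Nonempty) (θ y : Fin n → ℝ) : ∃! p, IsNearest (dirCone Ω θ) y p := by
  have key : ∀ v : Fin n → ℝ,
      v ⬝ᵥ v = dist (WithLp.toLp 2 v : EuclideanSpace ℝ (Fin n)) 0 ^ 2 := by
    intro v
    rw [dist_zero_right, EuclideanSpace.norm_sq_eq]
    simp [dotProduct, sq]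
  have hd : ∀ v w : Fin n → ℝ, (v - w) ⬝ᵥ (v - w) =
      dist (WithLp.toLp 2 v : EuclideanSpace ℝ (Fin n)) (WithLp.toLp 2 w) ^ 2 := by
    intro v w
    rw [key, dist_zero_right, dist_eq_norm, WithLp.toLp_sub]
  have hcl : IsClosed (dirCone Ω θ) := isClosed_closure
  have hcv : Convex ℝ (dirCone Ω θ) := by
    refine Convex.closure ?_
    rintro _ ⟨z, hz, a, ha, rfl⟩ _ ⟨w, hw, b, hb, rfl⟩ s t hs ht -
    rcases (add_nonneg (mul_nonneg hs ha) (mul_nonneg ht hb)).eq_or_lt with h0 | hpos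
    · have h1 : s * a = 0 := by nlinarith [mul_nonneg hs ha, mul_nonneg ht hb]
      have h2 : t * b = 0 := by nlinarith [mul_nonneg hs ha, mul_nonneg ht hb]
      exact ⟨z, hz, 0, le_rfl, by simp [smul_smul, h1, h2]⟩
    · refine ⟨(s * a / (s * a + t * b)) • z + (t * b / (s * a + t * b)) • w,
        hΩ hz hw (by positivity) (by positivity) (by field_simp), s * a + t * b, hpos.le, ?_⟩
      ext i
      simp only [Pi.add_apply, Pi.smul_apply, Pi.sub_apply, smul_eq_mul]
      field_simp
      ring
  have hn : (dirCone Ω θ).Nonempty := by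
    obtain ⟨z, hz⟩ := hne
    exact ⟨0, subset_closure ⟨z, hz, 0, le_rfl, by simp⟩⟩
  have hcl' : IsClosed ((WithLp.ofLp : EuclideanSpace ℝ (Fin n) → (Fin n → ℝ)) ⁻¹' dirCone Ω θ) :=
    hcl.preimage (by fun_prop)
  obtain ⟨p, hp, hpd⟩ := hcl'.exists_infDist_eq_dist
    (by obtain ⟨v, hv⟩ := hn; exact ⟨WithLp.toLp 2 v, hv⟩) (WithLp.toLp 2 y)
  have hP : IsNearest (dirCone Ω θ) y p.ofLp := by
    refine ⟨hp, fun v hv => ?_⟩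
    rw [hd, hd]
    have : dist (WithLp.toLp 2 y) p ≤ dist (WithLp.toLp 2 y) (WithLp.toLp 2 v) := by
      rw [← hpd]
      exact Metric.infDist_le_dist_of_mem hv
    exact pow_le_pow_left₀ dist_nonneg this 2
  refine ⟨_, hP, fun q hq => ?_⟩
  set p' := p.ofLp
  have hm := hP.2 _ (hcv hP.1 hq.1 (a := 1 / 2) (b := 1 / 2) (by norm_num) (by norm_num)
    (by norm_num))
  have h2 := hq.2 _ hP.1
  have e1 : y - ((1 / 2 : ℝ) • p' + (1 / 2 : ℝ) • q)
      = (1 / 2 : ℝ) • (y - p') + (1 / 2 : ℝ) • (y - q) := by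
    ext i; simp; ring
  have e2 : q - p' = (y - p') - (y - q) := by ext i; simp
  have h3 : (q - p') ⬝ᵥ (q - p') ≤ 0 := by
    rw [e1] at hm
    rw [e2]
    simp only [dotProduct_add, add_dotProduct, dotProduct_smul, smul_dotProduct, smul_eq_mul,
      dotProduct_sub (y - p') , dotProduct_sub (y - q),
      sub_dotProduct (y - p') (y - q)] at hm ⊢
    have hc : (y - q) ⬝ᵥ (y - p') = (y - p') ⬝ᵥ (y - q) := dotProduct_comm _ _
    simp only [dotProduct_sub, sub_dotProduct] at hm h2 hc ⊢
    linarith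
  have h4 : (q - p') ⬝ᵥ (q - p') = 0 := le_antisymm h3 (by
    simp only [dotProduct]; exact Finset.sum_nonneg fun i _ => mul_self_nonneg _)
  exact sub_eq_zero.1 (dotProduct_self_eq_zero.1 h4)

/-- The defining property of `Proj`. -/
theorem isNearest_proj {n : ℕ} {Ω : Set (Fin n → ℝ)} (hΩ : Convex ℝ Ω) (hne : Ω.Nonempty)
    (θ y : Fin n → ℝ) : IsNearest (dirCone Ω θ) y (Proj Ω θ y) :=
  Classical.epsilon_spec (existsUnique_isNearest hΩ hne θ y).exists

/-- The plant `x' = A x + b (u - θᵀ x)` on `[0, ∞)`. -/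
def IsPlantTrajectory {n : ℕ} (A : Matrix (Fin n) (Fin n) ℝ) (b θ : Fin n → ℝ)
    (u : ℝ → ℝ) (x : ℝ → Fin n → ℝ) : Prop :=
  ∀ t, 0 ≤ t → HasDerivWithinAt x (A *ᵥ x t + (u t - θ ⬝ᵥ x t) • b) (Ici 0) t

/-- The closed loop of the plant with the `L₁` adaptive controller; the variables are the plant
state `x`, the predictor state `xh`, the parameter estimate `θh`, the control `u` and its adaptive
part `u₂`. -/
structure IsAdaptiveClosedLoop {n : ℕ} (A : Matrix (Fin n) (Fin n) ℝ) (b c K θ : Fin n → ℝ)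
    (Ω : Set (Fin n → ℝ)) (C : StrictlyProperSystem) (P : Matrix (Fin n) (Fin n) ℝ) (Γc : ℝ)
    (r : ℝ → ℝ) (x₀ θh₀ : Fin n → ℝ)
    (x xh θh : ℝ → Fin n → ℝ) (u u₂ : ℝ → ℝ) : Prop where
  /-- the plant -/
  plant : IsPlantTrajectory A b θ u x
  plant_init : x 0 = x₀
  /-- the control law `u = -Kᵀ x + u₂` -/
  control : ∀ t, 0 ≤ t → u t = -(K ⬝ᵥ x t) + u₂ t
  /-- the state predictor `x̂' = A_m x̂ - b θ̂ᵀ x + b u₂` -/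
  predictor : ∀ t, 0 ≤ t → HasDerivWithinAt xh
    (closedMatrix A b K *ᵥ xh t - (θh t ⬝ᵥ x t) • b + u₂ t • b) (Ici 0) t
  predictor_init : xh 0 = x₀
  /-- the adaptive law `θ̂' = Γ Proj(θ̂, x x̃ᵀ P b)`, `x̃ = x̂ - x`, `Γ = Γ_c I`; since `Proj` is
  discontinuous, solutions are understood in the sense of Carathéodory -/
  estimate_ac : ∀ T, 0 ≤ T → AbsolutelyContinuousOnInterval θh 0 T
  estimate : ∀ᵐ t, 0 < t →
    HasDerivAt θh (Γc • Proj Ω (θh t) (((xh t - x t) ⬝ᵥ (P *ᵥ b)) • x t)) t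
  estimate_init : θh 0 = θh₀
  /-- the filter `u₂(s) = C(s) (r̄(s) + k_g r(s))`, `r̄ = θ̂ᵀ x` -/
  filter : ∀ t, 0 ≤ t →
    u₂ t = C.response (fun τ => θh τ ⬝ᵥ x τ + kg (closedMatrix A b K) b c * r τ) t

/-- The nonadaptive closed-loop reference system: the plant with the control
`u_ref(s) = C(s) (k_g r(s) + η(s)) - Kᵀ x_ref(s)`, `η = θᵀ x_ref`. -/
structure IsReferenceClosedLoop {n : ℕ} (A : Matrix (Fin n) (Fin n) ℝ) (b c K θ : Fin n → ℝ)
    (C : StrictlyProperSystem) (r : ℝ → ℝ) (xref : ℝ → Fin n → ℝ) (uref : ℝ → ℝ) : Prop where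
  plant : IsPlantTrajectory A b θ uref xref
  control : ∀ t, 0 ≤ t → uref t =
    C.response (fun τ => kg (closedMatrix A b K) b c * r τ + θ ⬝ᵥ xref τ) t - K ⬝ᵥ xref t

end L1Adaptive

end

/-! The prediction error `e = x̂ - x` satisfies `e' = A_m e - q b` with `q = (θ̂ - θ)ᵀ x`. The
function `eᵀ P e + |θ̂ - θ|² / Γ_c` decreases at least at the rate `eᵀ Q e`: the adaptive law
cancels the cross term, and the projection can only help because `θ ∈ Ω` (`lyapunov_sub_le`). Hence
`e` is bounded before anything is known about `x`.

The estimate stays in `Ω` (`mem_of_hasDerivAt_mem_dirCone`), so `|θ̂ᵀ x| ≤ θ_max ‖x‖` in the sup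
norm. The predictor state is a bounded signal plus `Ḡ * (θ̂ᵀ x)`, and `x = x̂ - e`; the gain
condition therefore bounds `x` by a small gain argument. Now `e'` is bounded too, and
`tendsto_zero_of_decrease` gives `e → 0`.

The proof does not need `q` itself to vanish at infinity. What it needs is that `C * q` does. Since
`q b = A_m e - e'` and `b ≠ 0`, this reduces to `C * e' → 0`, where integration by parts moves the
derivative onto the smooth, exponentially decaying impulse response of `C`
(`tendsto_filtered_error`).

Finally `y = x - x_ref` equals a vanishing signal plus `Ḡ * (θᵀ y)`, so the same gain condition, now
used asymptotically, gives `y → 0` (`tendsto_zero_of_conv_small_gain`). The control difference is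
`-Kᵀ y + C * (θᵀ y) + C * q`, and every term vanishes. The initial state of the reference system
enters only through a decaying exponential. -/

noncomputable section

namespace L1Adaptive

/-! ### Matrix exponentials and their decay for Hurwitz matrices. -/

open scoped Matrix.Norms.Operator in
theorem hasDerivAt_exp_smul_mulVec {n : ℕ} (A : Matrix (Fin n) (Fin n) ℝ) (v : Fin n → ℝ)
    (t : ℝ) : HasDerivAt (fun s : ℝ => NormedSpace.exp (s • A) *ᵥ v)
      (A *ᵥ (NormedSpace.exp (t • A) *ᵥ v)) t := by
  have h := hasDerivAt_exp_smul_const' (𝕂 := ℝ) A t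
  have h2 := ((LinearMap.toContinuousLinearMap
    ((Matrix.mulVecBilin ℝ ℝ).flip v)).hasFDerivAt.comp_hasDerivAt t h)
  rw [Matrix.mulVec_mulVec]
  exact h2

open scoped Matrix.Norms.Operator in
theorem hasDerivAt_exp_smul_mulVec' {n : ℕ} (A : Matrix (Fin n) (Fin n) ℝ) (v : Fin n → ℝ)
    (t : ℝ) : HasDerivAt (fun s : ℝ => NormedSpace.exp (s • A) *ᵥ v)
      (NormedSpace.exp (t • A) *ᵥ (A *ᵥ v)) t := by
  have h := hasDerivAt_exp_smul_const (𝕂 := ℝ) A t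
  have h2 := ((LinearMap.toContinuousLinearMap
    ((Matrix.mulVecBilin ℝ ℝ).flip v)).hasFDerivAt.comp_hasDerivAt t h)
  rw [Matrix.mulVec_mulVec]
  exact h2

theorem continuous_stateImpulse {n : ℕ} (A : Matrix (Fin n) (Fin n) ℝ) (b : Fin n → ℝ) :
    Continuous (stateImpulse A b) :=
  continuous_iff_continuousAt.2 fun t => (hasDerivAt_exp_smul_mulVec A b t).continuousAt

theorem stateImpulse_zero {n : ℕ} (A : Matrix (Fin n) (Fin n) ℝ) (b : Fin n → ℝ) :
    stateImpulse A b 0 = b := by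
  simp [stateImpulse]

theorem exp_add_smul {n : ℕ} (A : Matrix (Fin n) (Fin n) ℝ) (s t : ℝ) :
    NormedSpace.exp ((s + t) • A) = NormedSpace.exp (s • A) * NormedSpace.exp (t • A) := by
  rw [add_smul]
  exact Matrix.exp_add_of_commute _ _ (((Commute.refl A).smul_left s).smul_right t)

open scoped Matrix.Norms.Operator in
theorem exp_map_ofReal {n : ℕ} (A : Matrix (Fin n) (Fin n) ℝ) :
    (NormedSpace.exp A).map (algebraMap ℝ ℂ) = NormedSpace.exp (A.map (algebraMap ℝ ℂ)) :=
  NormedSpace.map_exp ((algebraMap ℝ ℂ).mapMatrix)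
    (continuous_id.matrix_map Complex.continuous_ofReal) A

open scoped Matrix.Norms.Operator in
/-- An eigenvector of `A` is an eigenvector of `exp A`. -/
theorem exp_mulVec_of_mulVec_eq_smul {n : ℕ} {A : Matrix (Fin n) (Fin n) ℂ} {z : ℂ}
    {v : Fin n → ℂ} (h : A *ᵥ v = z • v) : NormedSpace.exp A *ᵥ v = Complex.exp z • v := by
  have hpow : ∀ k : ℕ, A ^ k *ᵥ v = z ^ k • v := by
    intro k
    induction k with
    | zero => simp
    | succ k ih => rw [pow_succ, ← Matrix.mulVec_mulVec, h, Matrix.mulVec_smul, ih, smul_smul,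
        pow_succ, mul_comm]
  have h1 := (NormedSpace.exp_series_hasSum_exp' (𝕂 := ℂ) A).mapL
    (LinearMap.toContinuousLinearMap ((Matrix.mulVecBilin ℂ ℂ).flip v))
  have h2 := (NormedSpace.exp_series_hasSum_exp' (𝕂 := ℂ) z).smul_const v
  rw [← Complex.exp_eq_exp_ℂ] at h2
  have key : (fun k : ℕ => (LinearMap.toContinuousLinearMap
      ((Matrix.mulVecBilin ℂ ℂ).flip v)) ((k.factorial : ℂ)⁻¹ • A ^ k)) =
      fun k : ℕ => ((k.factorial : ℂ)⁻¹ • z ^ k) • v := by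
    funext k
    change ((k.factorial : ℂ)⁻¹ • A ^ k) *ᵥ v = _
    rw [Matrix.smul_mulVec, hpow, smul_smul, smul_eq_mul]
  exact (key ▸ h1).unique h2

/-- The eigenvalues of `exp A` are the exponentials of eigenvalues of `A`. -/
theorem exists_exp_eq_of_mem_spectrum_exp {n : ℕ} {A : Matrix (Fin n) (Fin n) ℂ} {μ : ℂ}
    (h : μ ∈ spectrum ℂ (NormedSpace.exp A)) : ∃ z ∈ spectrum ℂ A, Complex.exp z = μ := by
  rw [← Matrix.spectrum_toLin', ← Module.End.hasEigenvalue_iff_mem_spectrum] at h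
  set f := Matrix.toLin' (NormedSpace.exp A)
  set g := Matrix.toLin' A
  -- `A` commutes with `exp A`, hence preserves the `μ`-eigenspace of `exp A`; an eigenvector of `A`
  -- found inside that space links the two eigenvalues.
  have hcomm : Commute f g := by
    have : Commute (NormedSpace.exp A) A := (Commute.refl A).exp_left
    change f * g = g * f
    simp only [f, g, Module.End.mul_eq_comp, ← Matrix.toLin'_mul, this.eq]
  have hmaps : MapsTo g (Module.End.eigenspace f μ) (Module.End.eigenspace f μ) :=
    Module.End.mapsTo_genEigenspace_of_comm hcomm.eq μ 1
  have hnt : Nontrivial (Module.End.eigenspace f μ) :=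
    (Submodule.nontrivial_iff_ne_bot).2 h
  obtain ⟨z, hz⟩ := Module.End.exists_eigenvalue (g.restrict hmaps)
  obtain ⟨w, hw⟩ := hz.exists_hasEigenvector
  have hw0 : (w : Fin n → ℂ) ≠ 0 := fun h0 => hw.2 (Subtype.ext h0)
  have hgw : g w = z • (w : Fin n → ℂ) := by
    exact congrArg Subtype.val hw.apply_eq_smul
  have hfw : f w = μ • (w : Fin n → ℂ) := Module.End.mem_eigenspace_iff.1 w.2
  refine ⟨z, ?_, ?_⟩
  · rw [← Matrix.spectrum_toLin', ← Module.End.hasEigenvalue_iff_mem_spectrum]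
    exact Module.End.hasEigenvalue_of_hasEigenvector ⟨Module.End.mem_eigenspace_iff.2 hgw, hw0⟩
  · have h1 : NormedSpace.exp A *ᵥ (w : Fin n → ℂ) = Complex.exp z • (w : Fin n → ℂ) :=
      exp_mulVec_of_mulVec_eq_smul (by simpa [g] using hgw)
    have h2 : NormedSpace.exp A *ᵥ (w : Fin n → ℂ) = μ • (w : Fin n → ℂ) := by
      simpa [f] using hfw
    exact smul_left_injective ℂ hw0 (h1.symm.trans h2)

-- Eigenvalues of `exp A` are `exp z` with `Re z < 0`, so its spectral radius is below one, and
-- Gelfand's formula turns this into a norm bound for some power.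
open scoped Matrix.Norms.Operator in
theorem exists_norm_exp_pow_lt_one {n : ℕ} {A : Matrix (Fin n) (Fin n) ℂ}
    (hA : ∀ z ∈ spectrum ℂ A, z.re < 0) : ∃ k : ℕ, 0 < k ∧ ‖NormedSpace.exp A ^ k‖ < 1 := by
  rcases subsingleton_or_nontrivial (Matrix (Fin n) (Fin n) ℂ) with hs | hs
  · exact ⟨1, one_pos, by rw [Subsingleton.elim (NormedSpace.exp A ^ 1) 0]; simp⟩
  have hr : spectralRadius ℂ (NormedSpace.exp A) < ((1 : NNReal) : ℝ≥0∞) := by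
    refine spectrum.spectralRadius_lt_of_forall_lt _ fun μ hμ => ?_
    obtain ⟨z, hz, rfl⟩ := exists_exp_eq_of_mem_spectrum_exp hμ
    rw [← NNReal.coe_lt_coe, coe_nnnorm, Complex.norm_exp, NNReal.coe_one]
    simpa using hA z hz
  have hg := (spectrum.pow_nnnorm_pow_one_div_tendsto_nhds_spectralRadius
    (NormedSpace.exp A)).eventually (gt_mem_nhds hr)
  obtain ⟨k, hk1, hk⟩ := ((eventually_gt_atTop 0).and hg).exists
  refine ⟨k, hk1, ?_⟩
  by_contra! h
  refine hk.not_ge (ENNReal.one_le_rpow ?_ (by positivity))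
  exact_mod_cast h

open scoped Matrix.Norms.Operator in
theorem norm_entry_le_opNorm {n : ℕ} (E : Matrix (Fin n) (Fin n) ℂ) (i j : Fin n) :
    ‖E i j‖ ≤ ‖E‖ := by
  rw [Matrix.linfty_opNorm_def, ← coe_nnnorm, NNReal.coe_le_coe]
  exact (Finset.single_le_sum (f := fun j => ‖E i j‖₊) (fun _ _ => zero_le) (Finset.mem_univ j)).trans
    (Finset.le_sup (f := fun i => ∑ j, ‖E i j‖₊) (Finset.mem_univ i))

open scoped Matrix.Norms.Operator in
/-- The matrix exponential of a Hurwitz matrix decays exponentially. -/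
theorem IsHurwitz.exists_exp_decay {n : ℕ} {A : Matrix (Fin n) (Fin n) ℝ} (hA : IsHurwitz A) :
    ∃ M lam : ℝ, 0 ≤ M ∧ 0 < lam ∧ ∀ t, 0 ≤ t → ∀ i j,
      |NormedSpace.exp (t • A) i j| ≤ M * Real.exp (-lam * t) := by
  set B : Matrix (Fin n) (Fin n) ℂ := A.map (algebraMap ℝ ℂ)
  obtain ⟨k, hk, hlt⟩ := exists_norm_exp_pow_lt_one hA
  have hkR : (0 : ℝ) < k := Nat.cast_pos.2 hk
  -- The `1 / 2` only keeps `q` positive, so that `Real.log q` and `q⁻¹` are usable.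
  set q : ℝ := max ‖NormedSpace.exp B ^ k‖ (1 / 2)
  have hq0 : 0 < q := lt_max_of_lt_right (by norm_num)
  have hq1 : q < 1 := max_lt hlt (by norm_num)
  set F : ℝ → Matrix (Fin n) (Fin n) ℂ := fun t => (NormedSpace.exp (t • A)).map (algebraMap ℝ ℂ)
  have hFc : Continuous F := by
    have : Continuous fun t : ℝ => NormedSpace.exp (t • A) :=
      continuous_iff_continuousAt.2 fun t => (hasDerivAt_exp_smul_const (𝕂 := ℝ) A t).continuousAt
    exact this.matrix_map Complex.continuous_ofReal
  have hFadd : ∀ s t, F (s + t) = F s * F t := fun s t => by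
    simp only [F, exp_add_smul, Matrix.map_mul]
  have hFk : F k = NormedSpace.exp B ^ k := by
    simp only [F, exp_map_ofReal]
    rw [← Matrix.exp_nsmul]
    congr 1
    ext i j
    simp [B]
  have hFmul : ∀ (m : ℕ) (s : ℝ), ‖F (m * k + s)‖ ≤ q ^ m * ‖F s‖ := by
    intro m s
    induction m with
    | zero => simp
    | succ m ih =>
      have : ((m + 1 : ℕ) : ℝ) * k + s = k + (m * k + s) := by push_cast; ring
      rw [this, hFadd, pow_succ', mul_assoc]
      refine (norm_mul_le _ _).trans ?_
      gcongr
      rw [hFk]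
      exact le_max_left _ _
  obtain ⟨M, hM⟩ := (isCompact_Icc (a := (0 : ℝ)) (b := k)).exists_bound_of_continuousOn
    hFc.continuousOn
  have hM0 : 0 ≤ M := (norm_nonneg _).trans (hM 0 ⟨le_rfl, hkR.le⟩)
  have hlog : Real.log q < 0 := Real.log_neg hq0 hq1
  refine ⟨M * q⁻¹, -Real.log q / k, by positivity, div_pos (by linarith) hkR, fun t ht i j => ?_⟩
  -- Split `t = m k + s` with `0 ≤ s ≤ k`: the `m` full periods give `q ^ m`, and compactness of
  -- `[0, k]` bounds the rest. Since `t / k ≤ m + 1`, passing from `q ^ m` to a true exponential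
  -- costs a factor `q⁻¹`.
  set m := ⌊t / k⌋₊
  have hm1 : (m : ℝ) * k ≤ t := (le_div_iff₀ hkR).1 (Nat.floor_le (by positivity))
  have hm2 : t < (m + 1) * k := (div_lt_iff₀ hkR).1 (Nat.lt_floor_add_one _)
  have h1 : |NormedSpace.exp (t • A) i j| ≤ ‖F t‖ := by
    refine le_trans (le_of_eq ?_) (norm_entry_le_opNorm (F t) i j)
    simp [F]
  have h2 : ‖F t‖ ≤ q ^ m * M := by
    have := hFmul m (t - m * k)
    rw [add_sub_cancel] at this
    exact this.trans (by gcongr; exact hM _ ⟨by linarith, by nlinarith⟩)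
  have h3 : q ^ m ≤ q⁻¹ * Real.exp (-(-Real.log q / k) * t) := by
    have : q ^ m = q⁻¹ * Real.exp (Real.log q * (m + 1)) := by
      rw [mul_add, mul_one, Real.exp_add, mul_comm _ (m : ℝ), Real.exp_nat_mul, Real.exp_log hq0]
      field_simp
    rw [this]
    refine mul_le_mul_of_nonneg_left (Real.exp_le_exp.2 ?_) (by positivity)
    have : t / k ≤ m + 1 := ((div_lt_iff₀ hkR).2 hm2).le
    calc Real.log q * (m + 1) ≤ Real.log q * (t / k) := mul_le_mul_of_nonpos_left this hlog.le
      _ = -(-Real.log q / k) * t := by ring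
  calc |NormedSpace.exp (t • A) i j| ≤ q ^ m * M := h1.trans h2
    _ ≤ q⁻¹ * Real.exp (-(-Real.log q / k) * t) * M := by gcongr
    _ = M * q⁻¹ * Real.exp (-(-Real.log q / k) * t) := by ring

/-! ### Causal convolutions. -/

/-- The causal convolution `(f * v)(t) = ∫₀ᵗ f (t - τ) v τ dτ`. -/
def conv (f v : ℝ → ℝ) (t : ℝ) : ℝ := ∫ τ in (0 : ℝ)..t, f (t - τ) * v τ

theorem uIcc_zero_subset_Ici {t : ℝ} (ht : 0 ≤ t) : uIcc 0 t ⊆ Ici 0 := by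
  rw [uIcc_of_le ht]
  exact Icc_subset_Ici_self

theorem conv_congr {f v w : ℝ → ℝ} (h : ∀ t, 0 ≤ t → v t = w t) {t : ℝ} (ht : 0 ≤ t) :
    conv f v t = conv f w t :=
  intervalIntegral.integral_congr fun τ hτ => by
    simp only [h τ (uIcc_zero_subset_Ici ht hτ)]

theorem conv_intervalIntegrable {f v : ℝ → ℝ} (hf : Continuous f) (hv : ContinuousOn v (Ici 0))
    {t : ℝ} (ht : 0 ≤ t) :
    IntervalIntegrable (fun τ => f (t - τ) * v τ) volume 0 t :=
  ContinuousOn.intervalIntegrable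
    ((by fun_prop : Continuous fun τ => f (t - τ)).continuousOn.mul
      (hv.mono (uIcc_zero_subset_Ici ht)))

theorem conv_add {f v w : ℝ → ℝ} (hf : Continuous f) (hv : ContinuousOn v (Ici 0))
    (hw : ContinuousOn w (Ici 0)) {t : ℝ} (ht : 0 ≤ t) :
    conv f (fun τ => v τ + w τ) t = conv f v t + conv f w t := by
  simp only [conv, mul_add]
  exact intervalIntegral.integral_add (conv_intervalIntegrable hf hv ht)
    (conv_intervalIntegrable hf hw ht)

theorem conv_sub {f v w : ℝ → ℝ} (hf : Continuous f) (hv : ContinuousOn v (Ici 0))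
    (hw : ContinuousOn w (Ici 0)) {t : ℝ} (ht : 0 ≤ t) :
    conv f (fun τ => v τ - w τ) t = conv f v t - conv f w t := by
  simp only [conv, mul_sub]
  exact intervalIntegral.integral_sub (conv_intervalIntegrable hf hv ht)
    (conv_intervalIntegrable hf hw ht)

theorem conv_sub_left {f g v : ℝ → ℝ} (hf : Continuous f) (hg : Continuous g)
    (hv : ContinuousOn v (Ici 0)) {t : ℝ} (ht : 0 ≤ t) :
    conv (fun τ => f τ - g τ) v t = conv f v t - conv g v t := by
  simp only [conv, sub_mul]
  exact intervalIntegral.integral_sub (conv_intervalIntegrable hf hv ht)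
    (conv_intervalIntegrable hg hv ht)

theorem conv_const_mul (f v : ℝ → ℝ) (a t : ℝ) :
    conv f (fun τ => a * v τ) t = a * conv f v t := by
  simp only [conv, mul_left_comm _ a]
  exact intervalIntegral.integral_const_mul _ _

theorem continuous_conv {f v : ℝ → ℝ} (hf : Continuous f) (hv : Continuous v) :
    Continuous (conv f v) := by
  unfold conv
  exact intervalIntegral.continuous_parametric_intervalIntegral_of_continuous
    (f := fun t τ => f (t - τ) * v τ) (by fun_prop) continuous_id

/-- The extension of a signal on `[0, ∞)` by its initial value. -/
def extend (v : ℝ → ℝ) (t : ℝ) : ℝ := v (max t 0)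

theorem extend_of_nonneg (v : ℝ → ℝ) {t : ℝ} (ht : 0 ≤ t) : extend v t = v t := by
  rw [extend, max_eq_left ht]

theorem continuous_extend {v : ℝ → ℝ} (hv : ContinuousOn v (Ici 0)) : Continuous (extend v) :=
  hv.comp_continuous (by fun_prop) fun t => mem_Ici.2 (le_max_right t 0)

theorem conv_extend (f v : ℝ → ℝ) {t : ℝ} (ht : 0 ≤ t) : conv f (extend v) t = conv f v t :=
  conv_congr (fun _ h => extend_of_nonneg v h) ht

/-- For `t ≥ 0` the convolution samples `v` only on `[0, t]`, so `v` may be replaced by its globally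
continuous extension. -/
theorem continuousOn_conv {f v : ℝ → ℝ} (hf : Continuous f) (hv : ContinuousOn v (Ici 0)) :
    ContinuousOn (conv f v) (Ici 0) :=
  (continuous_conv hf (continuous_extend hv)).continuousOn.congr fun _ h =>
    (conv_extend f v h).symm

/-- Fubini on the square, applied to `F` times the indicator of the triangle `σ ≤ τ`. -/
theorem integral_integral_triangle {F : ℝ → ℝ → ℝ} (hF : Continuous (Function.uncurry F)) {t : ℝ}
    (ht : 0 ≤ t) : ∫ τ in (0 : ℝ)..t, ∫ σ in (0 : ℝ)..τ, F τ σ =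
      ∫ σ in (0 : ℝ)..t, ∫ τ in σ..t, F τ σ := by
  set G : ℝ → ℝ → ℝ := fun τ σ => {p : ℝ × ℝ | p.2 ≤ p.1}.indicator (Function.uncurry F) (τ, σ)
  have hG : IntegrableOn (Function.uncurry G) (uIoc 0 t ×ˢ uIoc 0 t) := by
    have h1 : IntegrableOn (Function.uncurry F) (Icc 0 t ×ˢ Icc 0 t) :=
      hF.continuousOn.integrableOn_compact (isCompact_Icc.prod isCompact_Icc)
    have h2 := h1.mono_set (s := uIoc 0 t ×ˢ uIoc 0 t) (by
      rw [uIoc_of_le ht]; exact prod_mono Ioc_subset_Icc_self Ioc_subset_Icc_self)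
    exact h2.indicator (measurableSet_le measurable_snd measurable_fst)
  have hswap := intervalIntegral_intervalIntegral_swap hG
  calc ∫ τ in (0 : ℝ)..t, ∫ σ in (0 : ℝ)..τ, F τ σ
      = ∫ τ in (0 : ℝ)..t, ∫ σ in (0 : ℝ)..t, G τ σ := by
        refine intervalIntegral.integral_congr fun τ hτ => ?_
        rw [uIcc_of_le ht] at hτ
        exact (intervalIntegral.integral_indicator (f := F τ) hτ).symm
    _ = ∫ σ in (0 : ℝ)..t, ∫ τ in (0 : ℝ)..t, G τ σ := hswap
    _ = ∫ σ in (0 : ℝ)..t, ∫ τ in σ..t, F τ σ := by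
        refine intervalIntegral.integral_congr_ae (Eventually.of_forall fun σ hσ => ?_)
        rw [uIoc_of_le ht] at hσ
        have h1 : (fun τ => G τ σ) = (Ici σ).indicator fun τ => F τ σ := by
          funext τ
          by_cases h : σ ≤ τ <;> simp [G, h]
        have h2 : Ioc 0 t ∩ Ici σ = Icc σ t := by
          ext τ
          simp only [mem_inter_iff, mem_Ioc, mem_Ici, mem_Icc]
          exact ⟨fun h => ⟨h.2, h.1.2⟩, fun h => ⟨⟨hσ.1.trans_le h.1, h.2⟩, h.1⟩⟩
        rw [h1, intervalIntegral.integral_of_le ht, intervalIntegral.integral_of_le hσ.2,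
          setIntegral_indicator measurableSet_Ici, h2, integral_Icc_eq_integral_Ioc]

/-- After exchanging the integrals over the triangle, the shift `ρ = τ - σ` turns the inner one into
`conv f g (t - σ)`. -/
theorem conv_assoc {f g v : ℝ → ℝ} (hf : Continuous f) (hg : Continuous g)
    (hv : ContinuousOn v (Ici 0)) {t : ℝ} (ht : 0 ≤ t) :
    conv f (conv g v) t = conv (conv f g) v t := by
  rw [← conv_extend _ v ht, conv_congr (fun s hs => (conv_extend g v hs).symm) ht]
  have hw := continuous_extend hv
  set w := extend v
  have h := integral_integral_triangle (F := fun τ σ => f (t - τ) * (g (τ - σ) * w σ))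
    (by fun_prop) ht
  simp only [intervalIntegral.integral_const_mul] at h
  refine h.trans (intervalIntegral.integral_congr fun σ _ => ?_)
  simp only [conv, ← mul_assoc, intervalIntegral.integral_mul_const]
  congr 1
  have := intervalIntegral.integral_comp_sub_right (a := σ) (b := t)
    (fun ρ => f (t - σ - ρ) * g ρ) σ
  simp only [sub_self] at this
  rw [← this]
  refine intervalIntegral.integral_congr fun τ _ => ?_
  change f (t - τ) * g (τ - σ) = f (t - σ - (τ - σ)) * g (τ - σ)
  rw [sub_sub_sub_cancel_right]

/-- Young's inequality `L¹ * L^∞ → L^∞`. By causality the input need only be bounded up to time `t`,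
which is what the small gain argument on a finite horizon uses. -/
theorem abs_conv_le {f v : ℝ → ℝ} (hf : Continuous f) (hfi : IntegrableOn f (Ioi 0)) {B t : ℝ}
    (ht : 0 ≤ t) (hB : ∀ τ, 0 ≤ τ → τ ≤ t → |v τ| ≤ B) :
    |conv f v t| ≤ (∫ s in Ioi (0 : ℝ), |f s|) * B := by
  have hB0 : 0 ≤ B := (abs_nonneg _).trans (hB 0 le_rfl ht)
  have h1 : |conv f v t| ≤ ∫ τ in (0 : ℝ)..t, |f (t - τ)| * B := by
    refine intervalIntegral.norm_integral_le_of_norm_le (E := ℝ) (μ := volume) ht (Eventually.of_forall fun τ hτ => ?_)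
      (Continuous.intervalIntegrable (μ := volume) (u := fun τ => |f (t - τ)| * B) (by fun_prop) _ _)
    rw [Real.norm_eq_abs, abs_mul]
    exact mul_le_mul_of_nonneg_left (hB τ hτ.1.le hτ.2) (abs_nonneg _)
  refine h1.trans ?_
  rw [intervalIntegral.integral_mul_const]
  refine mul_le_mul_of_nonneg_right ?_ hB0
  have := intervalIntegral.integral_comp_sub_left (a := 0) (b := t) (fun s => |f s|) t
  rw [this, sub_self, sub_zero, intervalIntegral.integral_of_le ht]
  exact setIntegral_mono_set hfi.abs (Eventually.of_forall fun _ => abs_nonneg _)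
    (Eventually.of_forall fun _ h => h.1)

/-- Asymptotic gain estimate: past inputs are forgotten. -/
theorem eventually_abs_conv_le {f v : ℝ → ℝ} (hf : Continuous f) (hfi : IntegrableOn f (Ioi 0))
    (hv : ContinuousOn v (Ici 0)) {η δ : ℝ} (hη : ∀ᶠ t in atTop, |v t| ≤ η)
    (hδ : 0 < δ) (hdecay : Tendsto f atTop (𝓝 0)) :
    ∀ᶠ t in atTop, |conv f v t| ≤ (∫ s in Ioi (0 : ℝ), |f s|) * η + δ := by
  obtain ⟨T, hT0, hT⟩ : ∃ T, 0 ≤ T ∧ ∀ t, T ≤ t → |v t| ≤ η := by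
    obtain ⟨T, hT⟩ := eventually_atTop.1 hη
    exact ⟨max T 0, le_max_right _ _, fun t ht => hT t (le_trans (le_max_left _ _) ht)⟩
  obtain ⟨B, hB⟩ := (isCompact_Icc (a := (0 : ℝ)) (b := T)).exists_bound_of_continuousOn
    (hv.mono Icc_subset_Ici_self)
  have hB0 : 0 ≤ B := (norm_nonneg _).trans (hB 0 ⟨le_rfl, hT0⟩)
  -- Inputs on `[0, T]`, of size at most `B`, contribute at most `ε B T ≤ δ` once the kernel is
  -- below `ε`. This holds for `t ≥ S + T`, because then `t - τ ≥ S` for all `τ ≤ T`.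
  set ε := δ / ((B + 1) * (T + 1))
  have hε : 0 < ε := by positivity
  obtain ⟨S, hS⟩ := eventually_atTop.1 ((hdecay.abs).eventually (gt_mem_nhds (by simpa using hε)))
  filter_upwards [eventually_ge_atTop (S + T), eventually_ge_atTop T] with t ht1 ht2
  have ht0 := hT0.trans ht2
  have hi := conv_intervalIntegrable hf hv ht0
  have hi1 : IntervalIntegrable (fun τ => f (t - τ) * v τ) volume 0 T :=
    hi.mono_set (by rw [uIcc_of_le hT0, uIcc_of_le ht0]; exact Icc_subset_Icc le_rfl ht2)
  have hi2 : IntervalIntegrable (fun τ => f (t - τ) * v τ) volume T t :=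
    hi.mono_set (by rw [uIcc_of_le ht2, uIcc_of_le ht0]; exact Icc_subset_Icc hT0 le_rfl)
  rw [conv, ← intervalIntegral.integral_add_adjacent_intervals hi1 hi2, add_comm]
  refine (abs_add_le _ _).trans (add_le_add ?_ ?_)
  · have h1 : |∫ τ in T..t, f (t - τ) * v τ| ≤ ∫ τ in T..t, |f (t - τ)| * η := by
      refine intervalIntegral.norm_integral_le_of_norm_le (E := ℝ) (μ := volume) ht2 (Eventually.of_forall fun τ hτ => ?_)
        (Continuous.intervalIntegrable (μ := volume) (u := fun τ => |f (t - τ)| * η) (by fun_prop) _ _)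
      rw [Real.norm_eq_abs, abs_mul]
      exact mul_le_mul_of_nonneg_left (hT τ hτ.1.le) (abs_nonneg _)
    refine h1.trans ?_
    rw [intervalIntegral.integral_mul_const]
    refine mul_le_mul_of_nonneg_right ?_ ((abs_nonneg _).trans (hT T le_rfl))
    have := intervalIntegral.integral_comp_sub_left (a := T) (b := t) (fun s => |f s|) t
    rw [this, sub_self, intervalIntegral.integral_of_le (by linarith)]
    exact setIntegral_mono_set hfi.abs (Eventually.of_forall fun _ => abs_nonneg _)
      (Eventually.of_forall fun _ h => h.1)
  · have h2 : ‖∫ τ in (0 : ℝ)..T, f (t - τ) * v τ‖ ≤ (ε * B) * |T - 0| := by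
      refine intervalIntegral.norm_integral_le_of_norm_le_const fun τ hτ => ?_
      rw [uIoc_of_le hT0] at hτ
      rw [norm_mul]
      exact mul_le_mul (hS _ (by linarith [hτ.2])).le (hB τ ⟨hτ.1.le, hτ.2⟩) (norm_nonneg _) hε.le
    rw [Real.norm_eq_abs, sub_zero, abs_of_nonneg hT0] at h2
    refine h2.trans ?_
    have : ε * ((B + 1) * (T + 1)) = δ := div_mul_cancel₀ _ (by positivity)
    nlinarith [mul_nonneg hε.le hB0, mul_nonneg hε.le hT0]

theorem tendsto_conv_zero {f v : ℝ → ℝ} (hf : Continuous f) (hfi : IntegrableOn f (Ioi 0))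
    (hdecay : Tendsto f atTop (𝓝 0)) (hv : ContinuousOn v (Ici 0))
    (hv0 : Tendsto v atTop (𝓝 0)) : Tendsto (conv f v) atTop (𝓝 0) := by
  rw [Metric.tendsto_nhds]
  intro ε hε
  set N := ∫ s in Ioi (0 : ℝ), |f s|
  have hN : 0 ≤ N := integral_nonneg fun _ => abs_nonneg _
  have hη : ∀ᶠ t in atTop, |v t| ≤ ε / (3 * (N + 1)) := by
    have := hv0.abs.eventually_lt_const (u := ε / (3 * (N + 1))) (by rw [abs_zero]; positivity)
    exact this.mono fun _ h => h.le
  filter_upwards [eventually_abs_conv_le hf hfi hv hη (δ := ε / 3) (by positivity) hdecay] with t ht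
  rw [Real.dist_eq, sub_zero]
  refine ht.trans_lt ?_
  have : N * (ε / (3 * (N + 1))) ≤ ε / 3 := by
    rw [mul_div_assoc', div_le_div_iff₀ (by positivity) (by norm_num)]
    nlinarith
  linarith

/-! ### Exponentially decaying kernels. -/

/-- Exponential decay on `[0, ∞)`. -/
def ExpDecay (f : ℝ → ℝ) : Prop :=
  ∃ M lam : ℝ, 0 ≤ M ∧ 0 < lam ∧ ∀ t, 0 ≤ t → |f t| ≤ M * Real.exp (-lam * t)

theorem ExpDecay.integrableOn {f : ℝ → ℝ} (h : ExpDecay f) (hf : Continuous f) :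
    IntegrableOn f (Ioi 0) := by
  obtain ⟨M, lam, -, hl, hM⟩ := h
  refine Integrable.mono' ((exp_neg_integrableOn_Ioi 0 hl).const_mul M)
    hf.aestronglyMeasurable ?_
  exact (ae_restrict_iff' measurableSet_Ioi).2 (Eventually.of_forall fun t ht => hM t (le_of_lt ht))

theorem ExpDecay.tendsto {f : ℝ → ℝ} (h : ExpDecay f) : Tendsto f atTop (𝓝 0) := by
  obtain ⟨M, lam, -, hl, hM⟩ := h
  have h1 : Tendsto (fun t : ℝ => M * Real.exp (-lam * t)) atTop (𝓝 0) := by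
    have : Tendsto (fun t : ℝ => -lam * t) atTop atBot :=
      tendsto_id.const_mul_atTop_of_neg (neg_neg_of_pos hl)
    simpa using (Real.tendsto_exp_atBot.comp this).const_mul M
  refine squeeze_zero_norm' ?_ h1
  filter_upwards [eventually_ge_atTop 0] with t ht using hM t ht

theorem ExpDecay.sum {ι : Type*} (s : Finset ι) {f : ι → ℝ → ℝ} (h : ∀ i ∈ s, ExpDecay (f i)) :
    ExpDecay fun t => ∑ i ∈ s, f i t := by
  classical
  induction s using Finset.induction_on with
  | empty => exact ⟨0, 1, le_rfl, one_pos, by simp⟩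
  | insert i s hi ih =>
    obtain ⟨M, l, hM, hl, h1⟩ := h i (Finset.mem_insert_self _ _)
    obtain ⟨N, m, hN, hm, h2⟩ := ih fun j hj => h j (Finset.mem_insert_of_mem hj)
    refine ⟨M + N, min l m, by positivity, lt_min hl hm, fun t ht => ?_⟩
    simp only [Finset.sum_insert hi, add_mul]
    refine (abs_add_le _ _).trans (add_le_add ((h1 t ht).trans ?_) ((h2 t ht).trans ?_))
    · gcongr; exact min_le_left _ _
    · gcongr; exact min_le_right _ _

theorem ExpDecay.const_mul {f : ℝ → ℝ} (h : ExpDecay f) (a : ℝ) : ExpDecay fun t => a * f t := by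
  obtain ⟨M, l, hM, hl, h1⟩ := h
  refine ⟨|a| * M, l, by positivity, hl, fun t ht => ?_⟩
  rw [abs_mul, mul_assoc]
  exact mul_le_mul_of_nonneg_left (h1 t ht) (abs_nonneg _)

theorem ExpDecay.sub {f g : ℝ → ℝ} (hf : ExpDecay f) (hg : ExpDecay g) :
    ExpDecay fun t => f t - g t := by
  have := ExpDecay.sum (Finset.univ : Finset (Fin 2)) (f := ![f, fun t => (-1) * g t])
    (by intro i _; fin_cases i; exacts [hf, hg.const_mul (-1)])
  simpa [Fin.sum_univ_two, sub_eq_add_neg] using this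

/-- With `k` the slower rate the integrand is at most `M N exp (-k t)`, so the integral is at most
`M N t exp (-k t)`; half of the rate is spent on absorbing the factor `t`. -/
theorem ExpDecay.conv {f g : ℝ → ℝ} (hf : ExpDecay f) (hg : ExpDecay g) :
    ExpDecay (conv f g) := by
  obtain ⟨M, l, hM, hl, h1⟩ := hf
  obtain ⟨N, m, hN, hm, h2⟩ := hg
  set k := min l m
  have hk : 0 < k := lt_min hl hm
  refine ⟨M * N * (2 / k), k / 2, by positivity, by positivity, fun t ht => ?_⟩
  have hb : ∀ τ ∈ uIoc 0 t, ‖f (t - τ) * g τ‖ ≤ M * N * Real.exp (-k * t) := by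
    intro τ hτ
    rw [uIoc_of_le ht] at hτ
    have e1 : |f (t - τ)| ≤ M * Real.exp (-k * (t - τ)) := by
      refine (h1 _ (by linarith [hτ.2])).trans ?_
      gcongr
      · linarith [hτ.2]
      · exact min_le_left _ _
    have e2 : |g τ| ≤ N * Real.exp (-k * τ) := by
      refine (h2 _ hτ.1.le).trans ?_
      gcongr
      · exact hτ.1.le
      · exact min_le_right _ _
    rw [Real.norm_eq_abs, abs_mul]
    refine (mul_le_mul e1 e2 (abs_nonneg _) (by positivity)).trans (le_of_eq ?_)
    rw [mul_mul_mul_comm, ← Real.exp_add]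
    ring_nf
  have h3 := intervalIntegral.norm_integral_le_of_norm_le_const hb
  rw [sub_zero, abs_of_nonneg ht] at h3
  refine h3.trans ?_
  have h4 : t ≤ 2 / k * Real.exp (k / 2 * t) := by
    have := Real.add_one_le_exp (k / 2 * t)
    have h5 : 2 / k * (k / 2 * t) = t := by field_simp
    have h6 : 0 < 2 / k := by positivity
    nlinarith
  have h7 : Real.exp (-k * t) * Real.exp (k / 2 * t) = Real.exp (-(k / 2) * t) := by
    rw [← Real.exp_add]; ring_nf
  calc M * N * Real.exp (-k * t) * t
      ≤ M * N * Real.exp (-k * t) * (2 / k * Real.exp (k / 2 * t)) := by gcongr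
    _ = M * N * (2 / k) * (Real.exp (-k * t) * Real.exp (k / 2 * t)) := by ring
    _ = _ := by rw [h7]

theorem ExpDecay.tendsto_conv {f v : ℝ → ℝ} (h : ExpDecay f) (hf : Continuous f)
    (hv : ContinuousOn v (Ici 0)) (hv0 : Tendsto v atTop (𝓝 0)) :
    Tendsto (L1Adaptive.conv f v) atTop (𝓝 0) :=
  tendsto_conv_zero hf (h.integrableOn hf) h.tendsto hv hv0

theorem IsHurwitz.expDecay_stateImpulse {n : ℕ} {A : Matrix (Fin n) (Fin n) ℝ} (hA : IsHurwitz A)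
    (b : Fin n → ℝ) (i : Fin n) : ExpDecay fun t => stateImpulse A b t i := by
  obtain ⟨M, l, hM, hl, h⟩ := hA.exists_exp_decay
  have : (fun t => stateImpulse A b t i) =
      fun t => ∑ j, b j * NormedSpace.exp (t • A) i j := by
    funext t
    simp [stateImpulse, Matrix.mulVec, dotProduct, mul_comm]
  rw [this]
  exact ExpDecay.sum _ fun j _ => ExpDecay.const_mul ⟨M, l, hM, hl, fun t ht => h t ht i j⟩ _

theorem continuous_stateImpulse_apply {n : ℕ} (A : Matrix (Fin n) (Fin n) ℝ) (b : Fin n → ℝ)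
    (i : Fin n) : Continuous fun t => stateImpulse A b t i :=
  (continuous_apply i).comp (continuous_stateImpulse A b)

theorem expDecay_dot_stateImpulse {n : ℕ} {A : Matrix (Fin n) (Fin n) ℝ} (hA : IsHurwitz A)
    (b c : Fin n → ℝ) : ExpDecay fun t => c ⬝ᵥ stateImpulse A b t :=
  ExpDecay.sum _ fun i _ => (hA.expDecay_stateImpulse b i).const_mul (c i)

theorem continuous_dot_stateImpulse {n : ℕ} (A : Matrix (Fin n) (Fin n) ℝ) (b c : Fin n → ℝ) :
    Continuous fun t => c ⬝ᵥ stateImpulse A b t :=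
  continuous_const.dotProduct (continuous_stateImpulse A b)

/-! ### Variation of constants and integration by parts on the half line. -/

theorem hasDerivWithinAt_dotProduct {n : ℕ} {f g : ℝ → Fin n → ℝ} {f' g' : Fin n → ℝ}
    {s : Set ℝ} {t : ℝ} (hf : HasDerivWithinAt f f' s t) (hg : HasDerivWithinAt g g' s t) :
    HasDerivWithinAt (fun τ => f τ ⬝ᵥ g τ) (f' ⬝ᵥ g t + f t ⬝ᵥ g') s t := by
  have := HasDerivWithinAt.fun_sum (u := Finset.univ) fun i _ =>
    (hasDerivWithinAt_pi.1 hf i).fun_mul (hasDerivWithinAt_pi.1 hg i)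
  rw [Finset.sum_add_distrib] at this
  exact this

theorem integral_eq_sub_of_hasDerivWithinAt_Ici {φ φ' : ℝ → ℝ} {s t : ℝ} (hs : 0 ≤ s) (hst : s ≤ t)
    (h : ∀ τ, s ≤ τ → τ ≤ t → HasDerivWithinAt φ (φ' τ) (Ici 0) τ)
    (hφ' : ContinuousOn φ' (Icc s t)) : ∫ τ in s..t, φ' τ = φ t - φ s := by
  refine intervalIntegral.integral_eq_sub_of_hasDerivAt_of_le hst ?_ ?_
    (ContinuousOn.intervalIntegrable (by rwa [uIcc_of_le hst]))
  · exact fun τ hτ => ((h τ hτ.1 hτ.2).continuousWithinAt).mono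
      fun x hx => hs.trans hx.1
  · exact fun τ hτ => (h τ hτ.1.le hτ.2.le).hasDerivAt (Ici_mem_nhds (hs.trans_lt hτ.1))

/-- Variation of constants. -/
theorem apply_eq_exp_add_conv {n : ℕ} {A : Matrix (Fin n) (Fin n) ℝ} {b : Fin n → ℝ}
    {y : ℝ → Fin n → ℝ} {f : ℝ → ℝ} (hf : ContinuousOn f (Ici 0))
    (hy : ∀ t, 0 ≤ t → HasDerivWithinAt y (A *ᵥ y t + f t • b) (Ici 0) t) {t : ℝ} (ht : 0 ≤ t)
    (i : Fin n) :
    y t i = stateImpulse A (y 0) t i + conv (fun s => stateImpulse A b s i) f t := by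
  -- The adjoint solution ending at the `i`-th basis vector at time `t`. In the derivative of `ρ ⬝ᵥ
  -- y` the terms with `A` cancel, leaving the convolution integrand, so only scalar integrals
  -- occur.
  set ρ : ℝ → Fin n → ℝ := fun τ => stateImpulse Aᵀ (Pi.single i 1) (t - τ)
  have hρdot : ∀ τ v, ρ τ ⬝ᵥ v = stateImpulse A v (t - τ) i := by
    intro τ v
    simp only [ρ, stateImpulse, ← Matrix.transpose_smul, Matrix.exp_transpose]
    rw [Matrix.mulVec_transpose, ← Matrix.dotProduct_mulVec, single_one_dotProduct]
  have hρ : ∀ τ, HasDerivWithinAt ρ (-(Aᵀ *ᵥ ρ τ)) (Ici 0) τ := by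
    intro τ
    have := (hasDerivAt_exp_smul_mulVec Aᵀ (Pi.single i 1) (t - τ)).scomp τ
      ((hasDerivAt_id τ).const_sub t)
    simpa [ρ, Function.comp_def, stateImpulse] using this.hasDerivWithinAt
  have hφ : ∀ τ, 0 ≤ τ → τ ≤ t → HasDerivWithinAt (fun τ => ρ τ ⬝ᵥ y τ)
      (stateImpulse A b (t - τ) i * f τ) (Ici 0) τ := by
    intro τ h0 _
    convert hasDerivWithinAt_dotProduct (hρ τ) (hy τ h0) using 1
    rw [dotProduct_add, dotProduct_smul, hρdot τ b, neg_dotProduct, Matrix.mulVec_transpose,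
      ← Matrix.dotProduct_mulVec, smul_eq_mul]
    ring
  have h := integral_eq_sub_of_hasDerivWithinAt_Ici le_rfl ht hφ
    (((continuous_stateImpulse_apply A b i).comp (by fun_prop : Continuous fun τ => t - τ)).continuousOn.mul
      (hf.mono Icc_subset_Ici_self))
  simp only [hρdot, sub_self, sub_zero, stateImpulse_zero] at h
  rw [conv, h]
  ring

/-- Integration by parts in a convolution. -/
theorem conv_deriv {f f' y y' : ℝ → ℝ} (hf : ∀ t, HasDerivAt f (f' t) t) (hf' : Continuous f')
    (hy : ∀ t, 0 ≤ t → HasDerivWithinAt y (y' t) (Ici 0) t) (hy' : ContinuousOn y' (Ici 0))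
    {t : ℝ} (ht : 0 ≤ t) : conv f y' t = f 0 * y t - f t * y 0 + conv f' y t := by
  have hfc : Continuous f := continuous_iff_continuousAt.2 fun t => (hf t).continuousAt
  have hyc : ContinuousOn y (Ici 0) := fun t ht => (hy t ht).continuousWithinAt
  have hφ : ∀ τ, 0 ≤ τ → τ ≤ t → HasDerivWithinAt (fun τ => f (t - τ) * y τ)
      (f (t - τ) * y' τ - f' (t - τ) * y τ) (Ici 0) τ := by
    intro τ h0 _
    have h1 := ((hf (t - τ)).comp τ ((hasDerivAt_id τ).const_sub t)).hasDerivWithinAt (s := Ici 0)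
    refine (h1.fun_mul (hy τ h0)).congr_deriv ?_
    simp only [Function.comp_apply]
    ring
  have h := integral_eq_sub_of_hasDerivWithinAt_Ici le_rfl ht hφ
    (((hfc.comp (by fun_prop : Continuous fun τ => t - τ)).continuousOn.mul
      (hy'.mono Icc_subset_Ici_self)).sub
      ((hf'.comp (by fun_prop : Continuous fun τ => t - τ)).continuousOn.mul
      (hyc.mono Icc_subset_Ici_self)))
  rw [intervalIntegral.integral_sub (conv_intervalIntegrable hfc hy' ht)
    (conv_intervalIntegrable hf' hyc ht)] at h
  simp only [sub_self, sub_zero] at h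
  simp only [conv]
  linarith

/-! ### The projection operator, Carathéodory solutions and viability. -/

/-- A sum of two generators is `a + a'` times a convex combination of points of `Ω` minus `θ`; the
closure inherits this. -/
theorem add_mem_dirCone {n : ℕ} {Ω : Set (Fin n → ℝ)} (hΩ : Convex ℝ Ω) {θ v w : Fin n → ℝ}
    (hv : v ∈ dirCone Ω θ) (hw : w ∈ dirCone Ω θ) : v + w ∈ dirCone Ω θ := by
  refine map_mem_closure₂ continuous_add hv hw ?_
  rintro _ ⟨z, hz, a, ha, rfl⟩ _ ⟨z', hz', a', ha', rfl⟩
  rcases (add_nonneg ha ha').eq_or_lt with h0 | hpos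
  · have h1 : a = 0 := by linarith
    have h2 : a' = 0 := by linarith
    exact ⟨z, hz, 0, le_rfl, by simp [h1, h2]⟩
  · refine ⟨(a / (a + a')) • z + (a' / (a + a')) • z',
      hΩ hz hz' (by positivity) (by positivity) (by field_simp), a + a', hpos.le, ?_⟩
    ext i
    simp only [Pi.add_apply, Pi.smul_apply, Pi.sub_apply, smul_eq_mul]
    field_simp
    ring

/-- The variational inequality of the projection operator. -/
theorem sub_proj_dotProduct_nonpos {n : ℕ} {Ω : Set (Fin n → ℝ)} (hΩ : Convex ℝ Ω)
    (θ y : Fin n → ℝ) {z : Fin n → ℝ} (hz : z ∈ Ω) : (y - Proj Ω θ y) ⬝ᵥ (z - θ) ≤ 0 := by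
  obtain ⟨hp, hmin⟩ := isNearest_proj hΩ ⟨z, hz⟩ θ y
  set p := Proj Ω θ y
  set v := z - θ
  -- Minimality of `p` against the competitor `p + s v`, which is again in the cone; the limit `s →
  -- 0⁺` isolates the first-order term.
  have key : ∀ s : ℝ, 0 < s → 2 * ((y - p) ⬝ᵥ v) ≤ s * (v ⬝ᵥ v) := by
    intro s hs
    have h1 := hmin (p + s • v)
      (add_mem_dirCone hΩ hp (subset_closure ⟨z, hz, s, hs.le, rfl⟩))
    rw [← sub_sub, sub_dotProduct (y - p) (s • v), dotProduct_sub (y - p) (y - p),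
      dotProduct_sub (s • v) (y - p)] at h1
    simp only [smul_dotProduct, dotProduct_smul, smul_eq_mul, dotProduct_comm v (y - p)] at h1
    have h2 : s * (2 * ((y - p) ⬝ᵥ v)) ≤ s * (s * (v ⬝ᵥ v)) := by linarith
    exact le_of_mul_le_mul_left h2 hs
  have hlim : Tendsto (fun s : ℝ => s * (v ⬝ᵥ v)) (𝓝[>] 0) (𝓝 0) := by
    have : Continuous fun s : ℝ => s * (v ⬝ᵥ v) := by fun_prop
    simpa using (this.tendsto 0).mono_left nhdsWithin_le_nhds
  have := ge_of_tendsto hlim (eventually_nhdsWithin_of_forall key)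
  linarith

theorem _root_.LipschitzWith.comp_absolutelyContinuousOnInterval {X Y : Type*}
    [PseudoMetricSpace X] [PseudoMetricSpace Y] {g : X → Y} {K : NNReal} (hg : LipschitzWith K g)
    {f : ℝ → X} {a b : ℝ} (hf : AbsolutelyContinuousOnInterval f a b) :
    AbsolutelyContinuousOnInterval (fun t => g (f t)) a b := by
  refine squeeze_zero (fun t => Finset.sum_nonneg fun _ _ => dist_nonneg) (fun t => ?_)
    (by simpa using Tendsto.const_mul (K : ℝ) hf)
  rw [Finset.mul_sum]
  exact Finset.sum_le_sum fun i _ => hg.dist_le_mul _ _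

theorem _root_.AbsolutelyContinuousOnInterval.sub_le_integral_of_ae_le {f g : ℝ → ℝ} {s t : ℝ}
    (hst : s ≤ t) (hf : AbsolutelyContinuousOnInterval f s t)
    (hg : IntervalIntegrable g volume s t)
    (h : ∀ᵐ τ, τ ∈ Ioc s t → ∀ d, HasDerivAt f d τ → d ≤ g τ) :
    f t - f s ≤ ∫ τ in s..t, g τ := by
  rw [← hf.integral_deriv_eq_sub]
  refine intervalIntegral.integral_mono_ae_restrict hst hf.intervalIntegrable_deriv hg ?_
  rw [← restrict_Ioc_eq_restrict_Icc]
  refine (ae_restrict_iff' measurableSet_Ioc).2 ?_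
  filter_upwards [h, hf.ae_differentiableAt] with τ h1 h2 hτ
  refine h1 hτ _ (h2 ?_).hasDerivAt
  rw [uIcc_of_le hst]
  exact Ioc_subset_Icc_self hτ

theorem continuousOn_Ici_of_absolutelyContinuous {E : Type*} [SeminormedAddCommGroup E] {f : ℝ → E}
    (h : ∀ T, 0 ≤ T → AbsolutelyContinuousOnInterval f 0 T) : ContinuousOn f (Ici 0) := by
  intro t ht
  have ht1 : (0 : ℝ) ≤ t + 1 := add_nonneg (mem_Ici.1 ht) zero_le_one
  have h1 : ContinuousOn f (Icc 0 (t + 1)) := by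
    rw [← uIcc_of_le ht1]
    exact (h (t + 1) ht1).continuousOn
  have h2 : Icc 0 (t + 1) ∈ 𝓝[Ici 0] t := by
    rw [← Ici_inter_Iic]
    exact inter_mem self_mem_nhdsWithin
      (mem_nhdsWithin_of_mem_nhds (Iic_mem_nhds (lt_add_one t)))
  exact (h1 t ⟨ht, (lt_add_one t).le⟩).mono_of_mem_nhdsWithin h2

/-- `Fin n → ℝ` carries the sup norm; `L` transports nearest-point arguments to Euclidean geometry.
-/
theorem exists_equiv_inner_eq_dotProduct (n : ℕ) :
    ∃ L : (Fin n → ℝ) ≃L[ℝ] EuclideanSpace ℝ (Fin n), ∀ u v, inner ℝ (L u) (L v) = u ⬝ᵥ v :=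
  ⟨(PiLp.continuousLinearEquiv 2 ℝ fun _ : Fin n => ℝ).symm, fun u v => by
    simp [PiLp.inner_apply, dotProduct, mul_comm]⟩

/-- Viability: a Carathéodory solution whose velocity lies in the tangent cone of a compact convex
set stays in this set. -/
theorem mem_of_hasDerivAt_mem_dirCone {n : ℕ} {Ω : Set (Fin n → ℝ)} (hc : IsCompact Ω)
    (hΩ : Convex ℝ Ω) {ϑ : ℝ → Fin n → ℝ} (h0 : ϑ 0 ∈ Ω)
    (hac : ∀ T, 0 ≤ T → AbsolutelyContinuousOnInterval ϑ 0 T)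
    (hd : ∀ᵐ t, 0 < t → ∃ v ∈ dirCone Ω (ϑ t), HasDerivAt ϑ v t) {t : ℝ} (ht : 0 ≤ t) :
    ϑ t ∈ Ω := by
  obtain ⟨L, hinner⟩ := exists_equiv_inner_eq_dotProduct n
  set S : Set (EuclideanSpace ℝ (Fin n)) := L '' Ω
  have hSc : IsCompact S := hc.image L.continuous
  have hSne : S.Nonempty := ⟨_, mem_image_of_mem L h0⟩
  have hSconv : Convex ℝ S := hΩ.linear_image L.toLinearMap
  -- The squared distance to `Ω` is absolutely continuous and starts at zero; it remains to see that
  -- its derivative is almost everywhere nonpositive. The argument also covers times at which `ϑ s`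
  -- might lie outside `Ω`.
  set d : ℝ → ℝ := fun s => Metric.infDist (L (ϑ s)) S
  have hdac : AbsolutelyContinuousOnInterval (fun s => d s * d s) 0 t := by
    have h1 : AbsolutelyContinuousOnInterval (fun s => L (ϑ s)) 0 t :=
      (L : (Fin n → ℝ) →L[ℝ] EuclideanSpace ℝ (Fin n)).lipschitz.comp_absolutelyContinuousOnInterval
        (hac t ht)
    have h2 := (Metric.lipschitz_infDist_pt S).comp_absolutelyContinuousOnInterval h1
    exact h2.fun_mul h2
  have hle : d t * d t - d 0 * d 0 ≤ ∫ _ in (0 : ℝ)..t, (0 : ℝ) := by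
    refine hdac.sub_le_integral_of_ae_le ht (by simp) ?_
    filter_upwards [hd] with s hs hst D hD
    obtain ⟨v, hv, hvd⟩ := hs hst.1
    obtain ⟨π, hπ, hdist⟩ := hSc.exists_infDist_eq_dist hSne (L (ϑ s))
    obtain ⟨p, hp, rfl⟩ := hπ
    set q := ϑ s - p
    have hvar : ∀ z ∈ Ω, q ⬝ᵥ (z - p) ≤ 0 := by
      intro z hz
      have h1 : ‖L (ϑ s) - L p‖ = ⨅ w : S, ‖L (ϑ s) - w‖ := by
        rw [← dist_eq_norm, ← hdist, Metric.infDist_eq_iInf]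
        simp only [dist_eq_norm]
      have h2 := (norm_eq_iInf_iff_real_inner_le_zero hSconv (mem_image_of_mem L hp)).1 h1 (L z)
        (mem_image_of_mem L hz)
      rwa [← map_sub, ← map_sub, hinner] at h2
    have hqv : q ⬝ᵥ v ≤ 0 := by
      have hcl : IsClosed {v | q ⬝ᵥ v ≤ 0} :=
        isClosed_le (continuous_const.dotProduct continuous_id) continuous_const
      refine (closure_minimal ?_ hcl) hv
      rintro _ ⟨z, hz, a, ha, rfl⟩
      have h1 : z - ϑ s = (z - p) - q := by simp [q]
      have h2 : 0 ≤ q ⬝ᵥ q := by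
        simp only [dotProduct]; exact Finset.sum_nonneg fun i _ => mul_self_nonneg _
      rw [mem_ofPred_eq, dotProduct_smul, h1, dotProduct_sub, smul_eq_mul]
      exact mul_nonpos_of_nonneg_of_nonpos ha (by linarith [hvar z hz])
    have hE : HasDerivAt (fun τ => (ϑ τ - p) ⬝ᵥ (ϑ τ - p)) (v ⬝ᵥ q + q ⬝ᵥ v) s := by
      have h1 : HasDerivWithinAt (fun τ => ϑ τ - p) v univ s := (hvd.sub_const p).hasDerivWithinAt
      exact (hasDerivWithinAt_dotProduct h1 h1).hasDerivAt univ_mem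
    have hsq : ∀ τ, (ϑ τ - p) ⬝ᵥ (ϑ τ - p) = dist (L (ϑ τ)) (L p) * dist (L (ϑ τ)) (L p) := by
      intro τ
      rw [dist_eq_norm, ← map_sub, ← hinner, real_inner_self_eq_norm_mul_norm]
    have hmin : IsLocalMin (fun τ => (ϑ τ - p) ⬝ᵥ (ϑ τ - p) - d τ * d τ) s := by
      refine Eventually.of_forall fun τ => ?_
      simp only [hsq, d, hdist, sub_self]
      have h1 : Metric.infDist (L (ϑ τ)) S ≤ dist (L (ϑ τ)) (L p) :=
        Metric.infDist_le_dist_of_mem (mem_image_of_mem L hp)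
      have := mul_self_le_mul_self Metric.infDist_nonneg h1
      linarith
    have := hmin.hasDerivAt_eq_zero (hE.sub hD)
    rw [dotProduct_comm v q] at this
    linarith
  have hd0 : d 0 = 0 := Metric.infDist_zero_of_mem (mem_image_of_mem L h0)
  rw [hd0, intervalIntegral.integral_zero] at hle
  have hdt : d t = 0 := by nlinarith [mul_self_nonneg (d t)]
  have hmem : L (ϑ t) ∈ S := (hSc.isClosed.mem_iff_infDist_zero hSne).2 hdt
  obtain ⟨z, hz, hzt⟩ := hmem
  rwa [← L.injective hzt]

/-! ### The Lyapunov equation. -/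

theorem hasDerivAt_quadratic_stateImpulse {n : ℕ} (A M : Matrix (Fin n) (Fin n) ℝ)
    (v w : Fin n → ℝ) (t : ℝ) :
    HasDerivAt (fun t => stateImpulse A v t ⬝ᵥ (M *ᵥ stateImpulse A w t))
      (stateImpulse A v t ⬝ᵥ ((Aᵀ * M + M * A) *ᵥ stateImpulse A w t)) t := by
  have h1 := (hasDerivAt_exp_smul_mulVec A v t).hasDerivWithinAt (s := univ)
  have h2 := ((LinearMap.toContinuousLinearMap M.mulVecLin).hasFDerivAt.comp_hasDerivAt t
    (hasDerivAt_exp_smul_mulVec A w t)).hasDerivWithinAt (s := univ)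
  refine ((hasDerivWithinAt_dotProduct h1 h2).hasDerivAt univ_mem).congr_deriv ?_
  simp only [Function.comp_apply, LinearMap.coe_toContinuousLinearMap', Matrix.mulVecLin_apply,
    stateImpulse, Matrix.add_mulVec, dotProduct_add, ← Matrix.mulVec_mulVec]
  rw [Matrix.dotProduct_mulVec _ Aᵀ, Matrix.vecMul_transpose]

theorem IsHurwitz.tendsto_quadratic_stateImpulse {n : ℕ} {A : Matrix (Fin n) (Fin n) ℝ}
    (hA : IsHurwitz A) (M : Matrix (Fin n) (Fin n) ℝ) (v w : Fin n → ℝ) :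
    Tendsto (fun t => stateImpulse A v t ⬝ᵥ (M *ᵥ stateImpulse A w t)) atTop (𝓝 0) := by
  have h : ∀ v, Tendsto (stateImpulse A v) atTop (𝓝 0) := fun v =>
    tendsto_pi_nhds.2 fun i => (hA.expDecay_stateImpulse v i).tendsto
  have hc : Continuous fun p : (Fin n → ℝ) × (Fin n → ℝ) => p.1 ⬝ᵥ (M *ᵥ p.2) := by fun_prop
  have := (hc.tendsto (0, 0)).comp ((h v).prodMk_nhds (h w))
  simpa [Function.comp_def] using this

/-- The solution of the Lyapunov equation of a Hurwitz matrix is symmetric. -/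
theorem IsHurwitz.transpose_eq_of_lyapunov {n : ℕ} {A P Q : Matrix (Fin n) (Fin n) ℝ}
    (hA : IsHurwitz A) (hQ : Qᵀ = Q) (hP : Aᵀ * P + P * A = -Q) : Pᵀ = P := by
  -- `Pᵀ - P` solves the homogeneous equation, so its bilinear form is constant along the flow; the
  -- flow decays, so that constant is zero.
  have hD : Aᵀ * (Pᵀ - P) + (Pᵀ - P) * A = 0 := by
    have h1 : Aᵀ * Pᵀ + Pᵀ * A = -Q := by
      have := congrArg Matrix.transpose hP
      simpa [Matrix.transpose_mul, add_comm, hQ] using this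
    rw [mul_sub, sub_mul, sub_add_sub_comm, h1, hP, sub_self]
  have hz : ∀ v w, v ⬝ᵥ ((Pᵀ - P) *ᵥ w) = 0 := by
    intro v w
    have hder := fun t => hasDerivAt_quadratic_stateImpulse A (Pᵀ - P) v w t
    simp only [hD, Matrix.zero_mulVec, dotProduct_zero] at hder
    have hconst := is_const_of_deriv_eq_zero (fun t => (hder t).differentiableAt)
      fun t => (hder t).deriv
    have hlim := hA.tendsto_quadratic_stateImpulse (Pᵀ - P) v w
    have h0 := tendsto_nhds_unique (tendsto_const_nhds.congr fun t => hconst 0 t) hlim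
    simpa [stateImpulse_zero] using h0
  rw [← sub_eq_zero]
  ext i j
  simpa using hz (Pi.single i 1) (Pi.single j 1)

/-- The solution of the Lyapunov equation of a Hurwitz matrix is positive definite. -/
theorem IsHurwitz.pos_of_lyapunov {n : ℕ} {A P Q : Matrix (Fin n) (Fin n) ℝ}
    (hA : IsHurwitz A) (hQ : ∀ v, v ≠ 0 → 0 < v ⬝ᵥ (Q *ᵥ v)) (hP : Aᵀ * P + P * A = -Q)
    {v : Fin n → ℝ} (hv : v ≠ 0) : 0 < v ⬝ᵥ (P *ᵥ v) := by
  have hQ0 : ∀ w, 0 ≤ w ⬝ᵥ (Q *ᵥ w) := fun w => by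
    rcases eq_or_ne w 0 with rfl | h
    · simp
    · exact (hQ w h).le
  set φ : ℝ → ℝ := fun t => stateImpulse A v t ⬝ᵥ (P *ᵥ stateImpulse A v t)
  have hder : ∀ t, HasDerivAt φ (-(stateImpulse A v t ⬝ᵥ (Q *ᵥ stateImpulse A v t))) t := by
    intro t
    have := hasDerivAt_quadratic_stateImpulse A P v v t
    rwa [hP, Matrix.neg_mulVec, dotProduct_neg] at this
  have hanti : Antitone φ := antitone_of_hasDerivAt_nonpos hder fun t => neg_nonpos.2 (hQ0 _)
  have hlim : Tendsto φ atTop (𝓝 0) := hA.tendsto_quadratic_stateImpulse P v v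
  have hnn : ∀ t, 0 ≤ φ t := fun t => hanti.le_of_tendsto hlim t
  have hφ0 : φ 0 = v ⬝ᵥ (P *ᵥ v) := by simp [φ, stateImpulse_zero]
  rw [← hφ0]
  -- If `φ 0 = 0`, then `0` minimises `φ`, contradicting the derivative `-vᵀ Q v < 0` there.
  refine lt_of_le_of_ne (hnn 0) fun h0 => ?_
  have hmin : IsLocalMin φ 0 := Eventually.of_forall fun t => by rw [← h0]; exact hnn t
  have := hmin.hasDerivAt_eq_zero (hder 0)
  rw [stateImpulse_zero] at this
  linarith [hQ v hv]

/-- A positive quadratic form dominates a multiple of the squared norm. -/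
theorem exists_le_quadratic {n : ℕ} {M : Matrix (Fin n) (Fin n) ℝ}
    (hM : ∀ v, v ≠ 0 → 0 < v ⬝ᵥ (M *ᵥ v)) :
    ∃ c : ℝ, 0 < c ∧ ∀ v : Fin n → ℝ, c * ‖v‖ ^ 2 ≤ v ⬝ᵥ (M *ᵥ v) := by
  have hcont : Continuous fun v : Fin n → ℝ => v ⬝ᵥ (M *ᵥ v) := by fun_prop
  obtain ⟨c, hc, hmin⟩ : ∃ c : ℝ, 0 < c ∧ ∀ v : Fin n → ℝ, ‖v‖ = 1 → c ≤ v ⬝ᵥ (M *ᵥ v) := by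
    rcases (Metric.sphere (0 : Fin n → ℝ) 1).eq_empty_or_nonempty with h | h
    · exact ⟨1, one_pos, fun v hv => absurd (mem_sphere_zero_iff_norm.2 hv) (by simp [h])⟩
    · obtain ⟨v, hv, hmin⟩ := (isCompact_sphere (0 : Fin n → ℝ) 1).exists_isMinOn h
        hcont.continuousOn
      refine ⟨_, hM v ?_, fun w hw => hmin (mem_sphere_zero_iff_norm.2 hw)⟩
      rintro rfl
      simp at hv
  refine ⟨c, hc, fun v => ?_⟩
  rcases eq_or_ne v 0 with rfl | hv
  · simp
  have hv' : 0 < ‖v‖ := norm_pos_iff.2 hv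
  have h1 := hmin (‖v‖⁻¹ • v) (by rw [norm_smul, norm_inv, norm_norm, inv_mul_cancel₀ hv'.ne'])
  rw [Matrix.mulVec_smul, smul_dotProduct, dotProduct_smul, smul_eq_mul, smul_eq_mul] at h1
  have h2 : ‖v‖ ^ 2 * (‖v‖⁻¹ * (‖v‖⁻¹ * (v ⬝ᵥ (M *ᵥ v)))) = v ⬝ᵥ (M *ᵥ v) := by field_simp
  rw [← h2, mul_comm]
  gcongr

/-! ### Gain constants, small gain and a Barbalat argument. -/

/-- Hölder for `ℓ¹` and `ℓ^∞`: the sup norm on states is the one matching both `thetaMax` and the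
row-wise maximum in `l1Gain`. -/
theorem abs_dotProduct_le {n : ℕ} (v w : Fin n → ℝ) : |v ⬝ᵥ w| ≤ (∑ i, |v i|) * ‖w‖ := by
  rw [dotProduct, Finset.sum_mul]
  refine (Finset.abs_sum_le_sum_abs _ _).trans (Finset.sum_le_sum fun i _ => ?_)
  rw [abs_mul]
  exact mul_le_mul_of_nonneg_left (norm_le_pi_norm w i) (abs_nonneg _)

theorem sum_abs_le_thetaMax {n : ℕ} {Ω : Set (Fin n → ℝ)} (hc : IsCompact Ω) {θ : Fin n → ℝ}
    (hθ : θ ∈ Ω) : ∑ i, |θ i| ≤ thetaMax Ω :=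
  le_csSup (hc.image (by fun_prop)).bddAbove (mem_image_of_mem _ hθ)

theorem abs_dotProduct_le_thetaMax {n : ℕ} {Ω : Set (Fin n → ℝ)} (hc : IsCompact Ω)
    {θ : Fin n → ℝ} (hθ : θ ∈ Ω) (w : Fin n → ℝ) : |θ ⬝ᵥ w| ≤ thetaMax Ω * ‖w‖ :=
  (abs_dotProduct_le θ w).trans
    (mul_le_mul_of_nonneg_right (sum_abs_le_thetaMax hc hθ) (norm_nonneg _))

theorem exists_gain_lt_one {n : ℕ} {g : ℝ → Fin n → ℝ} {a : ℝ}
    (hg : ∀ i, IntegrableOn (fun t => g t i) (Ioi 0))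
    (h : l1Gain g * ENNReal.ofReal a < 1) :
    ∃ ρ : ℝ, 0 ≤ ρ ∧ ρ < 1 ∧ ∀ i, (∫ t in Ioi (0 : ℝ), |g t i|) * a ≤ ρ := by
  refine ⟨(l1Gain g * ENNReal.ofReal a).toReal, ENNReal.toReal_nonneg, ?_, fun i => ?_⟩
  · simpa using (ENNReal.toReal_lt_toReal (h.trans ENNReal.one_lt_top).ne ENNReal.one_ne_top).2 h
  · rw [← ENNReal.ofReal_le_iff_le_toReal (h.trans ENNReal.one_lt_top).ne,
      ENNReal.ofReal_mul (integral_nonneg fun _ => abs_nonneg _)]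
    refine mul_le_mul_left ?_ _
    have := ofReal_integral_norm_eq_lintegral_enorm (hg i)
    simp only [Real.norm_eq_abs] at this
    rw [this]
    exact le_iSup (fun i => ∫⁻ t in Ioi (0 : ℝ), ‖g t i‖ₑ) i

/-- Small gain: boundedness. -/
theorem norm_le_of_small_gain {E : Type*} [NormedAddCommGroup E] {w : ℝ → E}
    (hw : ContinuousOn w (Ici 0)) {D ρ : ℝ} (hρ : ρ < 1)
    (h : ∀ t, 0 ≤ t → ∀ X, (∀ τ, 0 ≤ τ → τ ≤ t → ‖w τ‖ ≤ X) → ‖w t‖ ≤ D + ρ * X) {t : ℝ}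
    (ht : 0 ≤ t) : ‖w t‖ ≤ D / (1 - ρ) := by
  -- At a maximiser `s` of `‖w‖` on `[0, t]` the hypothesis applies with `X = ‖w s‖`, giving `X ≤ D
  -- + ρ X`; no a priori bound is needed.
  obtain ⟨s, hs, hmax⟩ := (isCompact_Icc (a := (0 : ℝ)) (b := t)).exists_isMaxOn ⟨0, le_rfl, ht⟩
    (hw.norm.mono Icc_subset_Ici_self)
  have h1 := h s hs.1 ‖w s‖ fun τ h0 h1 => hmax (show τ ∈ Icc 0 t from ⟨h0, h1.trans hs.2⟩)
  refine (hmax (show t ∈ Icc 0 t from ⟨ht, le_rfl⟩)).trans ?_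
  rw [le_div_iff₀ (by linarith)]
  linarith

/-- Small gain: convergence. -/
theorem tendsto_zero_of_small_gain {E : Type*} [NormedAddCommGroup E] {w : ℝ → E} {B ρ : ℝ}
    (hB : ∀ᶠ t in atTop, ‖w t‖ ≤ B) (hρ0 : 0 ≤ ρ) (hρ : ρ < 1)
    (h : ∀ η, (∀ᶠ t in atTop, ‖w t‖ ≤ η) → ∀ δ, 0 < δ → ∀ᶠ t in atTop, ‖w t‖ ≤ ρ * η + δ) :
    Tendsto w atTop (𝓝 0) := by
  -- `sInf S` is the limit superior of `‖w‖`. The choice of `ε` below makes `ρ (L + ε) + ε < L` when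
  -- `L > 0`, contradicting minimality.
  set S : Set ℝ := {η | ∀ᶠ t in atTop, ‖w t‖ ≤ η}
  have hS0 : ∀ η ∈ S, 0 ≤ η := fun η hη => by
    obtain ⟨t, ht⟩ := Eventually.exists (p := fun t => ‖w t‖ ≤ η) hη
    exact (norm_nonneg _).trans ht
  have hne : S.Nonempty := ⟨B, hB⟩
  have hbdd : BddBelow S := ⟨0, hS0⟩
  have hL : sInf S ≤ 0 := by
    by_contra! hpos
    set L := sInf S
    set ε := (1 - ρ) * L / 4
    have hε : 0 < ε := by have : 0 < 1 - ρ := by linarith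
                          positivity
    obtain ⟨η, hη, hlt⟩ := exists_lt_of_csInf_lt hne (lt_add_of_pos_right L hε)
    have h1 : L ≤ ρ * η + ε := csInf_le hbdd (h η hη ε hε)
    have h2 : ρ * η ≤ ρ * (L + ε) := mul_le_mul_of_nonneg_left hlt.le hρ0
    have h3 : 4 * ε = (1 - ρ) * L := by simp only [ε]; ring
    nlinarith
  rw [Metric.tendsto_nhds]
  intro ε hε
  obtain ⟨η, hη, hlt⟩ := exists_lt_of_csInf_lt hne (hL.trans_lt hε)
  filter_upwards [hη] with t ht
  rw [dist_zero_right]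
  exact ht.trans_lt hlt

theorem exists_bound_of_tendsto {f : ℝ → ℝ} (hf : ContinuousOn f (Ici 0)) {l : ℝ}
    (h : Tendsto f atTop (𝓝 l)) : ∃ B, ∀ t, 0 ≤ t → |f t| ≤ B := by
  obtain ⟨T, hT⟩ := eventually_atTop.1 (h.abs.eventually_le_const (lt_add_one |l|))
  obtain ⟨B, hB⟩ := (isCompact_Icc (a := (0 : ℝ)) (b := T)).exists_bound_of_continuousOn
    (hf.mono Icc_subset_Ici_self)
  refine ⟨max B (|l| + 1), fun t ht => ?_⟩
  rcases le_total t T with h1 | h1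
  · exact (hB t ⟨ht, h1⟩).trans (le_max_left _ _)
  · exact (hT t h1).trans (le_max_right _ _)

/-- Small gain theorem for `y = d + g * p` with `|p| ≤ a ‖y‖` and `d` vanishing at infinity. -/
theorem tendsto_zero_of_conv_small_gain {n : ℕ} {y : ℝ → Fin n → ℝ} (hy : ContinuousOn y (Ici 0))
    {d g : ℝ → Fin n → ℝ} {p : ℝ → ℝ} (hp : ContinuousOn p (Ici 0))
    (hd : ∀ i, ContinuousOn (fun t => d t i) (Ici 0))
    (hd0 : ∀ i, Tendsto (fun t => d t i) atTop (𝓝 0))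
    (hgc : ∀ i, Continuous fun t => g t i) (hg : ∀ i, ExpDecay fun t => g t i)
    (hyd : ∀ t, 0 ≤ t → ∀ i, y t i = d t i + conv (fun s => g s i) p t)
    {a ρ : ℝ} (ha : 0 ≤ a) (hpy : ∀ t, 0 ≤ t → |p t| ≤ a * ‖y t‖) (hρ0 : 0 ≤ ρ) (hρ : ρ < 1)
    (hgain : ∀ i, (∫ t in Ioi (0 : ℝ), |g t i|) * a ≤ ρ) : Tendsto y atTop (𝓝 0) := by
  have hgi : ∀ i, IntegrableOn (fun t => g t i) (Ioi 0) := fun i => (hg i).integrableOn (hgc i)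
  choose B hB using fun i => exists_bound_of_tendsto (hd i) (hd0 i)
  have hB0 : ∀ i, 0 ≤ B i := fun i => (abs_nonneg _).trans (hB i 0 le_rfl)
  have hbdd : ∀ t, 0 ≤ t → ‖y t‖ ≤ (∑ i, B i) / (1 - ρ) := by
    intro t ht
    refine norm_le_of_small_gain hy hρ (fun t ht X hX => ?_) ht
    have hX0 : 0 ≤ X := (norm_nonneg _).trans (hX 0 le_rfl ht)
    refine (pi_norm_le_iff_of_nonneg (add_nonneg (Finset.sum_nonneg fun i _ => hB0 i)
      (mul_nonneg hρ0 hX0))).2 fun i => ?_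
    rw [hyd t ht i, Real.norm_eq_abs]
    refine (abs_add_le _ _).trans (add_le_add ((hB i t ht).trans
      (Finset.single_le_sum (fun i _ => hB0 i) (Finset.mem_univ i))) ?_)
    refine (abs_conv_le (hgc i) (hgi i) ht (B := a * X) fun τ h0 h1 =>
      (hpy τ h0).trans (mul_le_mul_of_nonneg_left (hX τ h0 h1) ha)).trans ?_
    rw [← mul_assoc]
    exact mul_le_mul_of_nonneg_right (hgain i) hX0
  refine tendsto_zero_of_small_gain (B := (∑ i, B i) / (1 - ρ)) ?_ hρ0 hρ fun η hη δ hδ => ?_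
  · filter_upwards [eventually_ge_atTop 0] with t ht using hbdd t ht
  · have hη0 : 0 ≤ η := by
      obtain ⟨t, ht⟩ := hη.exists
      exact (norm_nonneg _).trans ht
    have hpη : ∀ᶠ t in atTop, |p t| ≤ a * η := by
      filter_upwards [hη, eventually_ge_atTop 0] with t h1 h2
      exact (hpy t h2).trans (mul_le_mul_of_nonneg_left h1 ha)
    have hall : ∀ i, ∀ᶠ t in atTop, |y t i| ≤ ρ * η + δ := by
      intro i
      have h1 := eventually_abs_conv_le (hgc i) (hgi i) hp hpη (half_pos hδ) (hg i).tendsto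
      have h2 : ∀ᶠ t in atTop, |d t i| ≤ δ / 2 :=
        (hd0 i).abs.eventually_le_const (by rw [abs_zero]; exact half_pos hδ)
      filter_upwards [h1, h2, eventually_ge_atTop 0] with t h1 h2 h3
      rw [hyd t h3 i]
      have h4 := mul_le_mul_of_nonneg_right (hgain i) hη0
      have h5 := abs_add_le (d t i) (conv (fun s => g s i) p t)
      rw [← mul_assoc] at h1
      linarith
    filter_upwards [eventually_all.2 hall] with t ht
    exact (pi_norm_le_iff_of_nonneg (by positivity)).2 ht

/-- A Barbalat-type lemma: if a nonnegative function decreases at least at the rate `‖e‖²`, up to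
a constant factor, and `e` has a bounded derivative, then `e` tends to zero. -/
theorem tendsto_zero_of_decrease {E : Type*} [NormedAddCommGroup E] [NormedSpace ℝ E]
    {e e' : ℝ → E} {V : ℝ → ℝ} {q B : ℝ} (hq : 0 < q)
    (he : ∀ t, 0 ≤ t → HasDerivWithinAt e (e' t) (Ici 0) t) (hB : ∀ t, 0 ≤ t → ‖e' t‖ ≤ B)
    (hV0 : ∀ t, 0 ≤ t → 0 ≤ V t)
    (hV : ∀ s t, 0 ≤ s → s ≤ t → V t - V s ≤ -∫ τ in s..t, q * ‖e τ‖ ^ 2) :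
    Tendsto e atTop (𝓝 0) := by
  have hec : ContinuousOn e (Ici 0) := fun t ht => (he t ht).continuousWithinAt
  have hB0 : 0 ≤ B := (norm_nonneg _).trans (hB 0 le_rfl)
  have hlip : ∀ s t, 0 ≤ s → s ≤ t → ‖e t - e s‖ ≤ B * (t - s) := fun s t hs hst =>
    norm_image_sub_le_of_norm_deriv_le_segment' (f' := e')
      (fun x hx => (he x (hs.trans hx.1)).mono fun y hy => hs.trans hy.1)
      (fun x hx => hB x (hs.trans hx.1)) t ⟨hst, le_rfl⟩
  have hanti : ∀ s t, 0 ≤ s → s ≤ t → V t ≤ V s := fun s t hs hst => by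
    have h1 := hV s t hs hst
    have h2 : 0 ≤ ∫ τ in s..t, q * ‖e τ‖ ^ 2 :=
      intervalIntegral.integral_nonneg hst fun τ _ => by positivity
    linarith
  set W : ℝ → ℝ := fun t => V (max t 0)
  have hWanti : Antitone W := fun s t hst =>
    hanti _ _ (le_max_right _ _) (max_le_max_right 0 hst)
  have hWlim : Tendsto W atTop (𝓝 (⨅ t, W t)) :=
    tendsto_atTop_ciInf hWanti ⟨0, by rintro _ ⟨t, rfl⟩; exact hV0 _ (le_max_right _ _)⟩
  rw [Metric.tendsto_nhds]
  intro ε hε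
  -- Within time `δ` the norm of `e` drops by at most `ε / 2`. If `‖e t‖ ≥ ε`, then `V` loses at
  -- least `κ` on `[t, t + δ]`, which convergence of `V` forbids for large `t`.
  set δ := ε / (2 * (B + 1))
  have hδ : 0 < δ := by positivity
  have hBδ : B * δ ≤ ε / 2 := by
    have : (B + 1) * δ = ε / 2 := by simp only [δ]; field_simp
    nlinarith
  set κ := q * (ε / 2) ^ 2 * δ
  have hκ : 0 < κ := by positivity
  have hdiff : Tendsto (fun t => W t - W (t + δ)) atTop (𝓝 0) := by
    simpa using hWlim.sub (hWlim.comp (tendsto_atTop_add_const_right _ δ tendsto_id))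
  filter_upwards [hdiff.eventually_lt_const hκ, eventually_ge_atTop 0] with t h1 ht
  by_contra! h2
  rw [dist_zero_right] at h2
  have h3 := hV t (t + δ) ht (by linarith)
  have h4 : κ ≤ ∫ τ in t..(t + δ), q * ‖e τ‖ ^ 2 := by
    have h5 : ∫ _ in t..(t + δ), q * (ε / 2) ^ 2 = κ := by
      rw [intervalIntegral.integral_const, smul_eq_mul, add_sub_cancel_left]
      ring
    rw [← h5]
    refine intervalIntegral.integral_mono_on (by linarith) (by simp) ?_ fun τ hτ => ?_
    · refine ContinuousOn.intervalIntegrable ?_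
      rw [uIcc_of_le (by linarith)]
      exact ((hec.norm.pow 2).const_mul q).mono fun τ hτ => ht.trans hτ.1
    · have h6 := hlip t τ ht hτ.1
      have h7 : B * (τ - t) ≤ B * δ := mul_le_mul_of_nonneg_left (by linarith [hτ.2]) hB0
      have h8 : ‖e t‖ ≤ ‖e τ‖ + ‖e τ - e t‖ := by
        rw [norm_sub_rev]
        exact norm_le_norm_add_norm_sub' _ _
      have h9 : ε / 2 ≤ ‖e τ‖ := by linarith
      gcongr
  have e1 : W t = V t := by simp only [W, max_eq_left ht]
  have e2 : W (t + δ) = V (t + δ) := by simp only [W, max_eq_left (by linarith : 0 ≤ t + δ)]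
  rw [e1, e2] at h1
  linarith

/-! ### The filter and `Ḡ` in the time domain. -/

theorem transferFn_zero_left {n : ℕ} (A : Matrix (Fin n) (Fin n) ℝ) (c : Fin n → ℝ) (s : ℝ) :
    transferFn A 0 c s = 0 := by
  simp [transferFn]

theorem closedMatrix_mulVec {n : ℕ} (A : Matrix (Fin n) (Fin n) ℝ) (b K v : Fin n → ℝ) :
    closedMatrix A b K *ᵥ v = A *ᵥ v - (K ⬝ᵥ v) • b := by
  rw [closedMatrix, Matrix.sub_mulVec, Matrix.vecMulVec_mulVec]
  simp

/-- The impulse response of `C` is continuous. -/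
theorem StrictlyProperSystem.continuous_impulse (C : StrictlyProperSystem) :
    Continuous C.impulse :=
  continuous_dot_stateImpulse C.A C.b C.c

theorem StrictlyProperSystem.Stable.expDecay_impulse {C : StrictlyProperSystem} (hC : C.Stable) :
    ExpDecay C.impulse :=
  expDecay_dot_stateImpulse hC C.b C.c

/-- The response of a stable strictly proper system to `y'` vanishes at infinity if `y` does. -/
theorem StrictlyProperSystem.Stable.tendsto_conv_deriv {C : StrictlyProperSystem} (hC : C.Stable)
    {y y' : ℝ → ℝ} (hy : ∀ t, 0 ≤ t → HasDerivWithinAt y (y' t) (Ici 0) t)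
    (hy' : ContinuousOn y' (Ici 0)) (h0 : Tendsto y atTop (𝓝 0)) :
    Tendsto (conv C.impulse y') atTop (𝓝 0) := by
  -- The derivative is the impulse response with input vector `C.A *ᵥ C.b`, hence also exponentially
  -- decaying.
  have hd : ∀ t, HasDerivAt C.impulse (C.c ⬝ᵥ stateImpulse C.A (C.A *ᵥ C.b) t) t := by
    intro t
    have h1 := (hasDerivAt_exp_smul_mulVec' C.A C.b t).hasDerivWithinAt (s := univ)
    have := (hasDerivWithinAt_dotProduct (hasDerivWithinAt_const t univ C.c) h1).hasDerivAt
      univ_mem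
    exact this.congr_deriv (by rw [zero_dotProduct, zero_add]; rfl)
  have hd' := continuous_dot_stateImpulse C.A (C.A *ᵥ C.b) C.c
  have hyc : ContinuousOn y (Ici 0) := fun t ht => (hy t ht).continuousWithinAt
  have h1 : Tendsto (fun t => C.impulse 0 * y t - C.impulse t * y 0 +
      conv (fun t => C.c ⬝ᵥ stateImpulse C.A (C.A *ᵥ C.b) t) y t) atTop (𝓝 0) := by
    simpa using ((h0.const_mul (C.impulse 0)).sub
      (hC.expDecay_impulse.tendsto.mul_const (y 0))).add
      ((expDecay_dot_stateImpulse hC (C.A *ᵥ C.b) C.c).tendsto_conv hd' hyc h0)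
  refine h1.congr' ?_
  filter_upwards [eventually_ge_atTop 0] with t ht
  exact (conv_deriv hd hd' hy hy' ht).symm

theorem continuous_gBar_apply {n : ℕ} (Am : Matrix (Fin n) (Fin n) ℝ) (b : Fin n → ℝ)
    (C : StrictlyProperSystem) (i : Fin n) : Continuous fun t => gBar Am b C t i :=
  (continuous_conv (continuous_stateImpulse_apply Am b i) C.continuous_impulse).sub
    (continuous_stateImpulse_apply Am b i)

theorem expDecay_gBar_apply {n : ℕ} {Am : Matrix (Fin n) (Fin n) ℝ} (hA : IsHurwitz Am)
    (b : Fin n → ℝ) {C : StrictlyProperSystem} (hC : C.Stable) (i : Fin n) :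
    ExpDecay fun t => gBar Am b C t i :=
  ((hA.expDecay_stateImpulse b i).conv hC.expDecay_impulse).sub (hA.expDecay_stateImpulse b i)

/-- `Ḡ = H_o (C - 1)` in the time domain. -/
theorem conv_gBar {n : ℕ} (Am : Matrix (Fin n) (Fin n) ℝ) (b : Fin n → ℝ)
    (C : StrictlyProperSystem) {v : ℝ → ℝ} (hv : ContinuousOn v (Ici 0)) (i : Fin n) {t : ℝ}
    (ht : 0 ≤ t) :
    conv (fun s => gBar Am b C s i) v t =
      conv (fun s => stateImpulse Am b s i) (fun τ => conv C.impulse v τ - v τ) t := by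
  have hh := continuous_stateImpulse_apply Am b i
  rw [conv_sub hh (continuousOn_conv C.continuous_impulse hv) hv ht,
    show conv (fun s => stateImpulse Am b s i) (fun τ => conv C.impulse v τ) t = _ from
      conv_assoc hh C.continuous_impulse hv ht,
    ← conv_sub_left (continuous_conv hh C.continuous_impulse) hh hv ht]
  rfl

/-! ### The Lyapunov estimate for the adaptive law. -/

theorem _root_.ContinuousOn.dotProduct {n : ℕ} {f g : ℝ → Fin n → ℝ} {s : Set ℝ}
    (hf : ContinuousOn f s) (hg : ContinuousOn g s) : ContinuousOn (fun t => f t ⬝ᵥ g t) s :=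
  continuousOn_finsetSum _ fun i _ =>
    (continuousOn_pi.1 hf i).mul (continuousOn_pi.1 hg i)

theorem absolutelyContinuousOnInterval_sub_dotProduct_self {n : ℕ} {ϑ : ℝ → Fin n → ℝ} {s t : ℝ}
    (θ : Fin n → ℝ) (h : AbsolutelyContinuousOnInterval ϑ s t) :
    AbsolutelyContinuousOnInterval (fun τ => (ϑ τ - θ) ⬝ᵥ (ϑ τ - θ)) s t := by
  obtain ⟨L, hL⟩ := exists_equiv_inner_eq_dotProduct n
  have h1 : AbsolutelyContinuousOnInterval (fun τ => L (ϑ τ)) s t :=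
    (L : (Fin n → ℝ) →L[ℝ] EuclideanSpace ℝ (Fin n)).lipschitz.comp_absolutelyContinuousOnInterval h
  have h2 : LipschitzWith 1 fun z : EuclideanSpace ℝ (Fin n) => dist z (L θ) :=
    LipschitzWith.dist_left _
  have h3 := h2.comp_absolutelyContinuousOnInterval h1
  have h4 : (fun τ => (ϑ τ - θ) ⬝ᵥ (ϑ τ - θ)) =
      fun τ => dist (L (ϑ τ)) (L θ) * dist (L (ϑ τ)) (L θ) := by
    funext τ
    rw [dist_eq_norm, ← map_sub, ← hL, real_inner_self_eq_norm_mul_norm]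
  rw [h4]
  exact h3.fun_mul h3

/-- The Lyapunov function `eᵀ P e + |θ̂ - θ|² / Γ` decreases at the rate `eᵀ Q e`. -/
theorem lyapunov_sub_le {n : ℕ} {Am P Q : Matrix (Fin n) (Fin n) ℝ} {b θ : Fin n → ℝ}
    {Ω : Set (Fin n → ℝ)} {Γ : ℝ} {e x θh : ℝ → Fin n → ℝ} (hPs : Pᵀ = P)
    (hP : Amᵀ * P + P * Am = -Q) (hΩ : Convex ℝ Ω) (hθ : θ ∈ Ω) (hΓ : 0 < Γ)
    (hx : ContinuousOn x (Ici 0))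
    (he : ∀ t, 0 ≤ t → HasDerivWithinAt e (Am *ᵥ e t - ((θh t - θ) ⬝ᵥ x t) • b) (Ici 0) t)
    (hac : ∀ T, 0 ≤ T → AbsolutelyContinuousOnInterval θh 0 T)
    (hest : ∀ᵐ t, 0 < t →
      HasDerivAt θh (Γ • Proj Ω (θh t) ((e t ⬝ᵥ (P *ᵥ b)) • x t)) t)
    {s t : ℝ} (hs : 0 ≤ s) (hst : s ≤ t) :
    (e t ⬝ᵥ (P *ᵥ e t) + Γ⁻¹ * ((θh t - θ) ⬝ᵥ (θh t - θ))) -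
      (e s ⬝ᵥ (P *ᵥ e s) + Γ⁻¹ * ((θh s - θ) ⬝ᵥ (θh s - θ))) ≤
      -∫ τ in s..t, e τ ⬝ᵥ (Q *ᵥ e τ) := by
  have hec : ContinuousOn e (Ici 0) := fun t ht => (he t ht).continuousWithinAt
  have hφc : ContinuousOn (fun t => θh t - θ) (Ici 0) :=
    (continuousOn_Ici_of_absolutelyContinuous hac).sub continuousOn_const
  set φ : ℝ → Fin n → ℝ := fun t => θh t - θ
  have hsub : Icc s t ⊆ Ici 0 := fun τ hτ => hs.trans hτ.1
  have hQc : ContinuousOn (fun τ => e τ ⬝ᵥ (Q *ᵥ e τ)) (Ici 0) :=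
    hec.dotProduct ((by fun_prop : Continuous fun v => Q *ᵥ v).comp_continuousOn hec)
  have hcc : ContinuousOn (fun τ => (e τ ⬝ᵥ (P *ᵥ b)) * (φ τ ⬝ᵥ x τ)) (Ici 0) :=
    (hec.dotProduct continuousOn_const).mul (hφc.dotProduct hx)
  have hPsymm : ∀ v w : Fin n → ℝ, v ⬝ᵥ (P *ᵥ w) = w ⬝ᵥ (P *ᵥ v) := by
    intro v w
    rw [Matrix.dotProduct_mulVec, ← Matrix.mulVec_transpose, hPs, dotProduct_comm]
  -- The quadratic part is differentiable everywhere and is integrated exactly; the parameter part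
  -- is only absolutely continuous and is handled separately in `hR`.
  have hS : ∀ τ, s ≤ τ → τ ≤ t → HasDerivWithinAt (fun τ => e τ ⬝ᵥ (P *ᵥ e τ))
      (-(e τ ⬝ᵥ (Q *ᵥ e τ)) - 2 * ((e τ ⬝ᵥ (P *ᵥ b)) * (φ τ ⬝ᵥ x τ))) (Ici 0) τ := by
    intro τ h0 _
    have h1 := he τ (hs.trans h0)
    have h2 := (LinearMap.toContinuousLinearMap P.mulVecLin).hasFDerivAt.comp_hasDerivWithinAt τ h1
    refine (hasDerivWithinAt_dotProduct h1 h2).congr_deriv ?_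
    simp only [Function.comp_apply, LinearMap.coe_toContinuousLinearMap', Matrix.mulVecLin_apply]
    have h3 : e τ ⬝ᵥ (Q *ᵥ e τ) = -(e τ ⬝ᵥ (P *ᵥ (Am *ᵥ e τ)) + e τ ⬝ᵥ (P *ᵥ (Am *ᵥ e τ))) := by
      have h4 : Q = -(Amᵀ * P + P * Am) := by rw [hP, neg_neg]
      rw [h4, Matrix.neg_mulVec, dotProduct_neg, Matrix.add_mulVec, dotProduct_add,
        ← Matrix.mulVec_mulVec, ← Matrix.mulVec_mulVec, Matrix.dotProduct_mulVec _ Amᵀ,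
        Matrix.vecMul_transpose, hPsymm (Am *ᵥ e τ)]
    rw [h3, hPsymm (Am *ᵥ e τ - _), Matrix.mulVec_sub, Matrix.mulVec_smul, dotProduct_sub,
      dotProduct_smul, smul_eq_mul]
    ring
  have hSint := integral_eq_sub_of_hasDerivWithinAt_Ici hs hst hS
    ((hQc.mono hsub).neg.sub ((hcc.mono hsub).const_mul 2))
  have hQi : IntervalIntegrable (fun τ => e τ ⬝ᵥ (Q *ᵥ e τ)) volume s t :=
    ContinuousOn.intervalIntegrable (by rw [uIcc_of_le hst]; exact hQc.mono hsub)
  have hci : IntervalIntegrable (fun τ => (e τ ⬝ᵥ (P *ᵥ b)) * (φ τ ⬝ᵥ x τ)) volume s t :=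
    ContinuousOn.intervalIntegrable (by rw [uIcc_of_le hst]; exact hcc.mono hsub)
  have hQi' : IntervalIntegrable (fun τ => -(e τ ⬝ᵥ (Q *ᵥ e τ))) volume s t := hQi.neg
  rw [intervalIntegral.integral_sub hQi' (hci.const_mul 2), intervalIntegral.integral_neg,
    intervalIntegral.integral_const_mul] at hSint
  -- The variational inequality of `Proj`, tested at `z = θ`, lets the unprojected direction bound
  -- the derivative. After multiplication by `Γ⁻¹` this cancels the cross term of `hS`.
  have hR : φ t ⬝ᵥ φ t - φ s ⬝ᵥ φ s ≤
      ∫ τ in s..t, (2 * Γ) * ((e τ ⬝ᵥ (P *ᵥ b)) * (φ τ ⬝ᵥ x τ)) := by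
    have hacst : AbsolutelyContinuousOnInterval θh s t := by
      refine (hac t (hs.trans hst)).mono ?_
      rw [uIcc_of_le hst, uIcc_of_le (hs.trans hst)]
      exact Icc_subset_Icc_left hs
    refine (absolutelyContinuousOnInterval_sub_dotProduct_self θ hacst).sub_le_integral_of_ae_le
      hst (hci.const_mul _) ?_
    filter_upwards [hest] with τ hτ hτm D hD
    have h1 : HasDerivWithinAt φ _ univ τ :=
      ((hτ (hs.trans_lt hτm.1)).sub_const θ).hasDerivWithinAt
    have h2 := hD.unique ((hasDerivWithinAt_dotProduct h1 h1).hasDerivAt univ_mem)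
    have h3 := sub_proj_dotProduct_nonpos hΩ (θh τ) ((e τ ⬝ᵥ (P *ᵥ b)) • x τ) hθ
    rw [← neg_sub (θh τ) θ, dotProduct_neg, sub_dotProduct, smul_dotProduct, smul_eq_mul,
      dotProduct_comm (x τ)] at h3
    rw [h2, dotProduct_comm (φ τ), smul_dotProduct, smul_eq_mul]
    change Γ * (_ ⬝ᵥ (θh τ - θ)) + Γ * (_ ⬝ᵥ (θh τ - θ)) ≤
      2 * Γ * (_ * ((θh τ - θ) ⬝ᵥ x τ))
    nlinarith
  rw [intervalIntegral.integral_const_mul] at hR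
  have hR' := mul_le_mul_of_nonneg_left hR (inv_nonneg.2 hΓ.le)
  have hcancel : ∀ I : ℝ, Γ⁻¹ * (2 * Γ * I) = 2 * I := fun I => by field_simp
  rw [hcancel, mul_sub] at hR'
  linarith

theorem IsPlantTrajectory.hasDerivWithinAt_closedMatrix {n : ℕ} {A : Matrix (Fin n) (Fin n) ℝ}
    {b θ K : Fin n → ℝ} {u v : ℝ → ℝ} {x : ℝ → Fin n → ℝ} (h : IsPlantTrajectory A b θ u x)
    (hu : ∀ t, 0 ≤ t → u t = v t - K ⬝ᵥ x t) {t : ℝ} (ht : 0 ≤ t) :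
    HasDerivWithinAt x (closedMatrix A b K *ᵥ x t + (v t - θ ⬝ᵥ x t) • b) (Ici 0) t := by
  refine (h t ht).congr_deriv ?_
  rw [closedMatrix_mulVec, hu t ht]
  module

/-! ### The adaptive closed loop. -/

section ClosedLoop

variable {n : ℕ} {A : Matrix (Fin n) (Fin n) ℝ} {b c K θ : Fin n → ℝ} {Ω : Set (Fin n → ℝ)}
  {C : StrictlyProperSystem} {P Q : Matrix (Fin n) (Fin n) ℝ} {Γc : ℝ} {r : ℝ → ℝ}
  {x₀ θh₀ : Fin n → ℝ} {x xh θh : ℝ → Fin n → ℝ} {u u₂ : ℝ → ℝ}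

namespace IsAdaptiveClosedLoop

theorem continuousOn_state (h : IsAdaptiveClosedLoop A b c K θ Ω C P Γc r x₀ θh₀ x xh θh u u₂) :
    ContinuousOn x (Ici 0) :=
  fun t ht => (h.plant t ht).continuousWithinAt

theorem continuousOn_estimate
    (h : IsAdaptiveClosedLoop A b c K θ Ω C P Γc r x₀ θh₀ x xh θh u u₂) :
    ContinuousOn θh (Ici 0) :=
  continuousOn_Ici_of_absolutelyContinuous h.estimate_ac

theorem continuousOn_estimate_dotProduct
    (h : IsAdaptiveClosedLoop A b c K θ Ω C P Γc r x₀ θh₀ x xh θh u u₂) :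
    ContinuousOn (fun t => θh t ⬝ᵥ x t) (Ici 0) :=
  h.continuousOn_estimate.dotProduct h.continuousOn_state

/-- `u₂` enters plant and predictor identically and cancels, leaving the parameter error as the only
input. -/
theorem hasDerivWithinAt_error
    (h : IsAdaptiveClosedLoop A b c K θ Ω C P Γc r x₀ θh₀ x xh θh u u₂) {t : ℝ} (ht : 0 ≤ t) :
    HasDerivWithinAt (fun t => xh t - x t)
      (closedMatrix A b K *ᵥ (xh t - x t) - ((θh t - θ) ⬝ᵥ x t) • b) (Ici 0) t := by
  have h1 := h.plant.hasDerivWithinAt_closedMatrix (K := K) (v := u₂)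
    (fun t ht => by rw [h.control t ht]; ring) ht
  refine ((h.predictor t ht).sub h1).congr_deriv ?_
  rw [Matrix.mulVec_sub, sub_dotProduct]
  module

/-- Viability applies because the tangent cone is stable under multiplication by `Γc`. -/
theorem estimate_mem (h : IsAdaptiveClosedLoop A b c K θ Ω C P Γc r x₀ θh₀ x xh θh u u₂)
    (hc : IsCompact Ω) (hΩ : Convex ℝ Ω) (hΓ : 0 < Γc) (h0 : θh₀ ∈ Ω) {t : ℝ} (ht : 0 ≤ t) :
    θh t ∈ Ω := by
  refine mem_of_hasDerivAt_mem_dirCone hc hΩ (by rwa [h.estimate_init]) h.estimate_ac ?_ ht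
  filter_upwards [h.estimate] with s hs h0s
  refine ⟨_, ?_, hs h0s⟩
  have hp := (isNearest_proj hΩ ⟨θh₀, h0⟩ (θh s) (((xh s - x s) ⬝ᵥ (P *ᵥ b)) • x s)).1
  refine map_mem_closure (continuous_const_smul Γc) hp ?_
  rintro _ ⟨z, hz, a, ha, rfl⟩
  exact ⟨z, hz, Γc * a, by positivity, by rw [smul_smul]⟩

/-- The variation of constants formula for the predictor. -/
theorem predictor_apply (h : IsAdaptiveClosedLoop A b c K θ Ω C P Γc r x₀ θh₀ x xh θh u u₂)
    (hr : ContinuousOn r (Ici 0)) {t : ℝ} (ht : 0 ≤ t) (i : Fin n) :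
    xh t i = stateImpulse (closedMatrix A b K) x₀ t i +
      conv (conv (fun s => stateImpulse (closedMatrix A b K) b s i) C.impulse)
        (fun τ => kg (closedMatrix A b K) b c * r τ) t +
      conv (fun s => gBar (closedMatrix A b K) b C s i) (fun τ => θh τ ⬝ᵥ x τ) t := by
  set Am := closedMatrix A b K
  have hv := h.continuousOn_estimate_dotProduct
  have hkr : ContinuousOn (fun τ => kg Am b c * r τ) (Ici 0) := hr.const_mul _
  have hC := C.continuous_impulse
  have hh := continuous_stateImpulse_apply Am b i
  have hu : ∀ t, 0 ≤ t → u₂ t = conv C.impulse (fun τ => θh τ ⬝ᵥ x τ) t +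
      conv C.impulse (fun τ => kg Am b c * r τ) t := fun t ht =>
    (h.filter t ht).trans (conv_add hC hv hkr ht)
  -- The predictor input `u₂ - θ̂ᵀ x` splits into `(C - 1) θ̂ᵀ x`, which produces `Ḡ`, and the
  -- filtered reference.
  have hf : ContinuousOn (fun τ => conv C.impulse (fun τ => θh τ ⬝ᵥ x τ) τ - θh τ ⬝ᵥ x τ)
      (Ici 0) := (continuousOn_conv hC hv).sub hv
  have hg := continuousOn_conv hC hkr
  have h1 := apply_eq_exp_add_conv (A := Am) (b := b) (y := xh) (hg.add hf) (fun t ht => by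
    refine (h.predictor t ht).congr_deriv ?_
    rw [hu t ht, Pi.add_apply]
    module) ht i
  rw [h1, h.predictor_init, conv_gBar Am b C hv i ht, ← conv_assoc hh hC hkr ht, add_assoc]
  congr 1
  exact conv_add hh hg hf ht

/-- The state of the closed loop is bounded if the prediction error is. -/
theorem exists_state_bound
    (h : IsAdaptiveClosedLoop A b c K θ Ω C P Γc r x₀ θh₀ x xh θh u u₂)
    (hc : IsCompact Ω) (hθh : ∀ t, 0 ≤ t → θh t ∈ Ω)
    (hr : ContinuousOn r (Ici 0)) (hrb : ∃ M, ∀ t, 0 ≤ t → |r t| ≤ M)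
    (hK : IsHurwitz (closedMatrix A b K)) (hC : C.Stable)
    {ρ : ℝ} (hρ0 : 0 ≤ ρ) (hρ : ρ < 1)
    (hgain : ∀ i, (∫ t in Ioi (0 : ℝ), |gBar (closedMatrix A b K) b C t i|) * thetaMax Ω ≤ ρ)
    {E : ℝ} (hE : ∀ t, 0 ≤ t → ‖xh t - x t‖ ≤ E) : ∃ X, ∀ t, 0 ≤ t → ‖x t‖ ≤ X := by
  set Am := closedMatrix A b K
  obtain ⟨M, hM⟩ := hrb
  have hE0 : 0 ≤ E := (norm_nonneg _).trans (hE 0 le_rfl)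
  have hhc := fun i => continuous_stateImpulse_apply Am b i
  have hhC := fun i => continuous_conv (hhc i) C.continuous_impulse
  have hhCd := fun i => (hK.expDecay_stateImpulse b i).conv hC.expDecay_impulse
  choose B hB using fun i => exists_bound_of_tendsto
    (continuous_stateImpulse_apply Am x₀ i).continuousOn (hK.expDecay_stateImpulse x₀ i).tendsto
  have hB0 : ∀ i, 0 ≤ B i := fun i => (abs_nonneg _).trans (hB i 0 le_rfl)
  have hkr : ∀ t, 0 ≤ t → |kg Am b c * r t| ≤ |kg Am b c| * M := fun t ht => by
    rw [abs_mul]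
    exact mul_le_mul_of_nonneg_left (hM t ht) (abs_nonneg _)
  have hkM : 0 ≤ |kg Am b c| * M := (abs_nonneg _).trans (hkr 0 le_rfl)
  set N : Fin n → ℝ := fun i =>
    (∫ s in Ioi (0 : ℝ), |conv (fun s => stateImpulse Am b s i) C.impulse s|) * (|kg Am b c| * M)
  have hN0 : ∀ i, 0 ≤ N i := fun i =>
    mul_nonneg (integral_nonneg fun _ => abs_nonneg _) hkM
  refine ⟨(E + ∑ i, (B i + N i)) / (1 - ρ), fun t ht =>
    norm_le_of_small_gain h.continuousOn_state hρ (fun t ht X hX => ?_) ht⟩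
  have hX0 : 0 ≤ X := (norm_nonneg _).trans (hX 0 le_rfl ht)
  have hsum : 0 ≤ ∑ i, (B i + N i) := Finset.sum_nonneg fun i _ => add_nonneg (hB0 i) (hN0 i)
  refine (pi_norm_le_iff_of_nonneg (by positivity)).2 fun i => ?_
  have h1 : |xh t i - x t i| ≤ E := (norm_le_pi_norm (xh t - x t) i).trans (hE t ht)
  have h2 : |conv (conv (fun s => stateImpulse Am b s i) C.impulse)
      (fun τ => kg Am b c * r τ) t| ≤ N i :=
    abs_conv_le (hhC i) ((hhCd i).integrableOn (hhC i)) ht fun τ h0 _ => hkr τ h0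
  have h3 : |conv (fun s => gBar Am b C s i) (fun τ => θh τ ⬝ᵥ x τ) t| ≤ ρ * X := by
    have hgc := continuous_gBar_apply Am b C i
    have hv : ∀ τ, 0 ≤ τ → τ ≤ t → |θh τ ⬝ᵥ x τ| ≤ thetaMax Ω * X := fun τ h0 h1 =>
      (abs_dotProduct_le_thetaMax hc (hθh τ h0) _).trans (mul_le_mul_of_nonneg_left (hX τ h0 h1)
        ((Finset.sum_nonneg fun _ _ => abs_nonneg _).trans (sum_abs_le_thetaMax hc (hθh τ h0))))
    refine (abs_conv_le hgc ((expDecay_gBar_apply hK b hC i).integrableOn hgc) ht hv).trans ?_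
    rw [← mul_assoc]
    exact mul_le_mul_of_nonneg_right (hgain i) hX0
  have h4 := h.predictor_apply hr ht i
  have h5 := Finset.single_le_sum (f := fun i => B i + N i)
    (fun i _ => add_nonneg (hB0 i) (hN0 i)) (Finset.mem_univ i)
  have h6 := hB i t ht
  rw [Real.norm_eq_abs]
  rw [abs_le] at h1 h2 h3 h6 ⊢
  constructor <;> linarith

/-- The prediction error is bounded, and it vanishes at infinity if the state is bounded. -/
theorem error_bounded_and_tendsto
    (h : IsAdaptiveClosedLoop A b c K θ Ω C P Γc r x₀ θh₀ x xh θh u u₂)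
    (hc : IsCompact Ω) (hΩ : Convex ℝ Ω) (hθ : θ ∈ Ω) (hθh : ∀ t, 0 ≤ t → θh t ∈ Ω)
    (hK : IsHurwitz (closedMatrix A b K)) (hQ : Q.PosDef)
    (hP : (closedMatrix A b K)ᵀ * P + P * closedMatrix A b K = -Q) (hΓ : 0 < Γc) :
    (∃ E, ∀ t, 0 ≤ t → ‖xh t - x t‖ ≤ E) ∧
      ((∃ X, ∀ t, 0 ≤ t → ‖x t‖ ≤ X) → Tendsto (fun t => xh t - x t) atTop (𝓝 0)) := by
  set Am := closedMatrix A b K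
  set e : ℝ → Fin n → ℝ := fun t => xh t - x t
  have hQpos : ∀ v, v ≠ 0 → 0 < v ⬝ᵥ (Q *ᵥ v) := fun v hv => by
    simpa using hQ.dotProduct_mulVec_pos hv
  have hQs : Qᵀ = Q := by simpa using hQ.isHermitian.eq
  obtain ⟨p, hp, hpP⟩ := exists_le_quadratic fun v hv => hK.pos_of_lyapunov hQpos hP (v := v) hv
  obtain ⟨q, hq, hqQ⟩ := exists_le_quadratic hQpos
  have he : ∀ t, 0 ≤ t → HasDerivWithinAt e (Am *ᵥ e t - ((θh t - θ) ⬝ᵥ x t) • b) (Ici 0) t :=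
    fun t ht => h.hasDerivWithinAt_error ht
  have hec : ContinuousOn e (Ici 0) := fun t ht => (he t ht).continuousWithinAt
  set V : ℝ → ℝ := fun t => e t ⬝ᵥ (P *ᵥ e t) + Γc⁻¹ * ((θh t - θ) ⬝ᵥ (θh t - θ))
  have hself : ∀ v : Fin n → ℝ, 0 ≤ v ⬝ᵥ v := fun v =>
    Finset.sum_nonneg fun i _ => mul_self_nonneg _
  have hpV : ∀ t, p * ‖e t‖ ^ 2 ≤ V t := fun t =>
    (hpP (e t)).trans (le_add_of_nonneg_right (mul_nonneg (inv_nonneg.2 hΓ.le) (hself _)))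
  have hV : ∀ s t, 0 ≤ s → s ≤ t → V t - V s ≤ -∫ τ in s..t, q * ‖e τ‖ ^ 2 := by
    intro s t hs hst
    refine (lyapunov_sub_le (hK.transpose_eq_of_lyapunov hQs hP) hP hΩ hθ hΓ
      h.continuousOn_state he h.estimate_ac h.estimate hs hst).trans (neg_le_neg ?_)
    have hsub : uIcc s t ⊆ Ici 0 := by
      rw [uIcc_of_le hst]
      exact fun τ hτ => hs.trans hτ.1
    refine intervalIntegral.integral_mono_on hst ?_ ?_ fun τ _ => hqQ (e τ)
    · exact (((hec.norm.pow 2).const_mul q).mono hsub).intervalIntegrable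
    · exact ((hec.dotProduct ((by fun_prop : Continuous fun v => Q *ᵥ v).comp_continuousOn
        hec)).mono hsub).intervalIntegrable
  obtain ⟨E, hE⟩ : ∃ E, ∀ t, 0 ≤ t → ‖e t‖ ≤ E := by
    -- From `p ‖e‖² ≤ V t ≤ V 0`; no bound on `x` enters.
    refine ⟨Real.sqrt (V 0 / p), fun t ht => Real.le_sqrt_of_sq_le ?_⟩
    rw [le_div_iff₀ hp, mul_comm]
    have h1 := hV 0 t le_rfl ht
    have h2 : 0 ≤ ∫ τ in (0 : ℝ)..t, q * ‖e τ‖ ^ 2 :=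
      intervalIntegral.integral_nonneg ht fun τ _ => by positivity
    linarith [hpV t]
  refine ⟨⟨E, hE⟩, ?_⟩
  rintro ⟨X, hX⟩
  set L := LinearMap.toContinuousLinearMap Am.mulVecLin
  refine tendsto_zero_of_decrease (B := ‖L‖ * E + (2 * thetaMax Ω * X) * ‖b‖) hq he
    (fun t ht => ?_) (fun t _ => le_trans (by positivity) (hpV t)) hV
  refine (norm_sub_le _ _).trans (add_le_add ?_ ?_)
  · exact (L.le_opNorm (e t)).trans (mul_le_mul_of_nonneg_left (hE t ht) (norm_nonneg _))
  · rw [norm_smul, Real.norm_eq_abs]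
    refine mul_le_mul_of_nonneg_right ?_ (norm_nonneg _)
    have hm : 0 ≤ thetaMax Ω :=
      (Finset.sum_nonneg fun _ _ => abs_nonneg _).trans (sum_abs_le_thetaMax hc hθ)
    have h1 := (abs_dotProduct_le_thetaMax hc (hθh t ht) (x t)).trans
      (mul_le_mul_of_nonneg_left (hX t ht) hm)
    have h2 := (abs_dotProduct_le_thetaMax hc hθ (x t)).trans
      (mul_le_mul_of_nonneg_left (hX t ht) hm)
    rw [sub_dotProduct]
    refine (abs_sub _ _).trans ?_
    linarith

/-- The low-pass filtered parameter error signal `C (θ̂ - θ)ᵀ x` vanishes at infinity. -/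
theorem tendsto_filtered_error
    (h : IsAdaptiveClosedLoop A b c K θ Ω C P Γc r x₀ θh₀ x xh θh u u₂) (hC : C.Stable)
    (hb : b ≠ 0) (he0 : Tendsto (fun t => xh t - x t) atTop (𝓝 0)) :
    Tendsto (conv C.impulse fun t => (θh t - θ) ⬝ᵥ x t) atTop (𝓝 0) := by
  set Am := closedMatrix A b K
  obtain ⟨j, hj⟩ : ∃ j, b j ≠ 0 := by
    by_contra! h0
    exact hb (funext h0)
  set q : ℝ → ℝ := fun t => (θh t - θ) ⬝ᵥ x t
  have hq : ContinuousOn q (Ici 0) :=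
    (h.continuousOn_estimate.sub continuousOn_const).dotProduct h.continuousOn_state
  set e : ℝ → Fin n → ℝ := fun t => xh t - x t
  have he : ∀ t, 0 ≤ t → HasDerivWithinAt e (Am *ᵥ e t - q t • b) (Ici 0) t :=
    fun t ht => h.hasDerivWithinAt_error ht
  have hec : ContinuousOn e (Ici 0) := fun t ht => (he t ht).continuousWithinAt
  set f : ℝ → ℝ := fun t => (Am *ᵥ e t) j
  have hAmj : Continuous fun v : Fin n → ℝ => (Am *ᵥ v) j := by fun_prop
  have hf : ContinuousOn f (Ici 0) := hAmj.comp_continuousOn hec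
  have hf0 : Tendsto f atTop (𝓝 0) := by
    simpa [Function.comp_def] using (hAmj.tendsto 0).comp he0
  have hbq : ContinuousOn (fun t => b j * q t) (Ici 0) := hq.const_mul _
  -- Here `f - b j * q` is the derivative of the `j`-th error component; dividing by `b j ≠ 0` at
  -- the end recovers `q`.
  have h1 : Tendsto (conv C.impulse fun t => f t - b j * q t) atTop (𝓝 0) := by
    refine hC.tendsto_conv_deriv (y := fun t => e t j) (fun t ht => ?_) (hf.sub hbq)
      (by simpa using tendsto_pi_nhds.1 he0 j)
    refine (hasDerivWithinAt_pi.1 (he t ht) j).congr_deriv ?_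
    simp [f, mul_comm]
  have h2 := hC.expDecay_impulse.tendsto_conv C.continuous_impulse hf hf0
  have h3 := (h2.sub h1).const_mul (b j)⁻¹
  rw [sub_zero, mul_zero] at h3
  refine h3.congr' ?_
  filter_upwards [eventually_ge_atTop 0] with t ht
  rw [conv_sub C.continuous_impulse hf hbq ht, sub_sub_cancel, conv_const_mul,
    inv_mul_cancel_left₀ hj]

end IsAdaptiveClosedLoop

end ClosedLoop

end L1Adaptive

end

/-! ### Comparison with the reference system. -/

theorem theorem2 {n : ℕ}
    -- the plant
    (A : Matrix (Fin n) (Fin n) ℝ) (b c : Fin n → ℝ) (hAb : L1Adaptive.IsControllable A b)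
    (Ω : Set (Fin n → ℝ)) (hΩc : IsCompact Ω) (hΩ : Convex ℝ Ω)
    (θ : Fin n → ℝ) (hθ : θ ∈ Ω) (x₀ : Fin n → ℝ)
    -- the reference input
    (r : ℝ → ℝ) (hr : ContinuousOn r (Ici 0)) (hrb : ∃ M, ∀ t, 0 ≤ t → |r t| ≤ M)
    -- the design parameters of the controller
    (K : Fin n → ℝ) (hK : L1Adaptive.IsHurwitz (L1Adaptive.closedMatrix A b K))
    (hkg : L1Adaptive.transferFn (L1Adaptive.closedMatrix A b K) b c 0 ≠ 0)
    (C : L1Adaptive.StrictlyProperSystem) (hC : C.Stable) (hC0 : C.transfer 0 = 1)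
    (P Q : Matrix (Fin n) (Fin n) ℝ) (hQ : Q.PosDef)
    (hP : (L1Adaptive.closedMatrix A b K)ᵀ * P + P * L1Adaptive.closedMatrix A b K = -Q)
    (Γc : ℝ) (hΓ : 0 < Γc) (θh₀ : Fin n → ℝ) (hθh₀ : θh₀ ∈ Ω)
    -- the gain requirement
    (hgain : L1Adaptive.l1Gain (L1Adaptive.gBar (L1Adaptive.closedMatrix A b K) b C)
      * ENNReal.ofReal (L1Adaptive.thetaMax Ω) < 1)
    -- the adaptive closed loop and the reference system
    (x xh θh : ℝ → Fin n → ℝ) (u u₂ : ℝ → ℝ)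
    (hloop : L1Adaptive.IsAdaptiveClosedLoop A b c K θ Ω C P Γc r x₀ θh₀ x xh θh u u₂)
    (xref : ℝ → Fin n → ℝ) (uref : ℝ → ℝ)
    (href : L1Adaptive.IsReferenceClosedLoop A b c K θ C r xref uref) :
    Tendsto (fun t => ‖(WithLp.toLp 2 (x t - xref t) : EuclideanSpace ℝ (Fin n))‖) atTop (𝓝 0) ∧
      Tendsto (fun t => |u t - uref t|) atTop (𝓝 0) := by
  open L1Adaptive in
  have hb : b ≠ 0 := by
    rintro rfl
    exact hkg (transferFn_zero_left _ _ _)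
  have hθh : ∀ t, 0 ≤ t → θh t ∈ Ω := fun t ht => hloop.estimate_mem hΩc hΩ hΓ hθh₀ ht
  set Am := closedMatrix A b K with hAm
  have hgc := continuous_gBar_apply Am b C
  have hgd := expDecay_gBar_apply hK b hC
  have hmax : 0 ≤ thetaMax Ω :=
    (Finset.sum_nonneg fun _ _ => abs_nonneg _).trans (sum_abs_le_thetaMax hΩc hθ)
  obtain ⟨ρ, hρ0, hρ, hg⟩ := exists_gain_lt_one (fun i => (hgd i).integrableOn (hgc i)) hgain
  obtain ⟨⟨E, hE⟩, hconv⟩ :=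
    hloop.error_bounded_and_tendsto hΩc hΩ hθ hθh hK hQ hP hΓ
  have he0 := hconv (hloop.exists_state_bound hΩc hθh hr hrb hK hC hρ0 hρ hg hE)
  have hω := hloop.tendsto_filtered_error hC hb he0
  have hCc := C.continuous_impulse
  have hxc := hloop.continuousOn_state
  have hxrc : ContinuousOn xref (Ici 0) := fun t ht => (href.plant t ht).continuousWithinAt
  set y : ℝ → Fin n → ℝ := fun t => x t - xref t with hy
  have hyc : ContinuousOn y (Ici 0) := hxc.sub hxrc
  set p : ℝ → ℝ := fun t => θ ⬝ᵥ y t with hp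
  have hpc : ContinuousOn p (Ici 0) := continuousOn_const.dotProduct hyc
  set q : ℝ → ℝ := fun t => (θh t - θ) ⬝ᵥ x t with hq
  have hqc : ContinuousOn q (Ici 0) :=
    (hloop.continuousOn_estimate.sub continuousOn_const).dotProduct hxc
  have hωc : ContinuousOn (conv C.impulse q) (Ici 0) := continuousOn_conv hCc hqc
  set v : ℝ → ℝ := fun t => kg Am b c * r t + θ ⬝ᵥ xref t with hv
  have hvc : ContinuousOn v (Ici 0) :=
    (hr.const_mul _).add (continuousOn_const.dotProduct hxrc)
  -- The filter input `θ̂ᵀ x + k_g r` is the reference input `v` plus `θᵀ y` plus `q`; subtracting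
  -- the reference loop removes `v`.
  have hu₂ : ∀ t, 0 ≤ t → u₂ t = conv C.impulse v t + (conv C.impulse p t + conv C.impulse q t) := by
    intro t ht
    have hpqc : ContinuousOn (fun τ => p τ + q τ) (Ici 0) := hpc.add hqc
    rw [hloop.filter t ht, ← conv_add hCc hpc hqc ht, ← conv_add hCc hvc hpqc ht]
    refine conv_congr (fun s _ => ?_) ht
    simp only [hv, hp, hq, hy, sub_dotProduct, dotProduct_sub]
    ring
  have hyder : ∀ t, 0 ≤ t → HasDerivWithinAt y
      (Am *ᵥ y t + ((conv C.impulse p t - p t) + conv C.impulse q t) • b) (Ici 0) t := by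
    intro t ht
    have h1 := hloop.plant.hasDerivWithinAt_closedMatrix (K := K) (v := u₂)
      (fun t ht => by rw [hloop.control t ht]; ring) ht
    have h2 := href.plant.hasDerivWithinAt_closedMatrix (K := K) (v := conv C.impulse v)
      (fun t ht => href.control t ht) ht
    refine (h1.sub h2).congr_deriv ?_
    rw [hu₂ t ht]
    simp only [hy, hp, Matrix.mulVec_sub, dotProduct_sub, ← hAm]
    module
  have hcpc : ContinuousOn (fun t => conv C.impulse p t - p t) (Ici 0) :=
    (continuousOn_conv hCc hpc).sub hpc
  have hh := continuous_stateImpulse_apply Am b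
  -- The disturbance `d` collects the initial mismatch and the response to `C * q`; both vanish at
  -- infinity.
  have hy0 : Tendsto y atTop (𝓝 0) := by
    refine tendsto_zero_of_conv_small_gain hyc (p := p) (g := gBar Am b C) (d := fun t i =>
      stateImpulse Am (y 0) t i + conv (fun s => stateImpulse Am b s i) (conv C.impulse q) t)
      hpc (fun i => ?_) (fun i => ?_) hgc hgd (fun t ht i => ?_) hmax
      (fun t _ => abs_dotProduct_le_thetaMax hΩc hθ _) hρ0 hρ hg
    · exact (continuous_stateImpulse_apply Am (y 0) i).continuousOn.add
        (continuousOn_conv (hh i) hωc)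
    · simpa using (hK.expDecay_stateImpulse (y 0) i).tendsto.add
        ((hK.expDecay_stateImpulse b i).tendsto_conv (hh i) hωc hω)
    · rw [apply_eq_exp_add_conv (hcpc.add hωc) hyder ht i, conv_gBar Am b C hpc i ht, add_assoc,
        add_comm (conv _ (conv C.impulse q) t)]
      congr 1
      exact conv_add (hh i) hcpc hωc ht
  have hdot : ∀ w : Fin n → ℝ, Tendsto (fun t => w ⬝ᵥ y t) atTop (𝓝 0) := fun w => by
    have : Continuous fun z : Fin n → ℝ => w ⬝ᵥ z := by fun_prop
    simpa [Function.comp_def] using (this.tendsto 0).comp hy0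
  constructor
  · have : Continuous fun z : Fin n → ℝ => ‖(WithLp.toLp 2 z : EuclideanSpace ℝ (Fin n))‖ := by
      fun_prop
    have h1 := (this.tendsto 0).comp hy0
    rwa [WithLp.toLp_zero, norm_zero] at h1
  · have h1 := hC.expDecay_impulse.tendsto_conv hCc hpc (hdot θ)
    have h2 := (((hdot K).neg.add h1).add hω).abs
    simp only [neg_zero, add_zero, abs_zero] at h2
    refine h2.congr' ?_
    filter_upwards [eventually_ge_atTop 0] with t ht
    have h3 : uref t = conv C.impulse v t - K ⬝ᵥ xref t := href.control t ht
    rw [hloop.control t ht, h3, hu₂ t ht]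
    congr 1
    simp only [hy, dotProduct_sub]
    ring
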